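/- Let $f:[0,\infty)\to\mathbb{R}$ be a standard operator monotone function: $0\le A\le B$ implies $f(A)\le f(B)$ for Hermitian matrices $A,B$ of every size, $f(x)=xf(1/x)$ for $x>0$, $f(1)=1$, and $f(0)=\lim_{x\downarrow 0}f(x)$. Let $c_f(x,y)=[y f(x/y)]^{-1}$ be its Morozova–Chentsov function, extended continuously to $c_f(x,0)=[x f(0)]^{-1}$ for $x>0$. For a density matrix $\rho$ and a Hermitian matrix $H$ on a finite-dimensional complex Hilbert space, the skew information is $$I^f(\rho,H)=\frac{f(0)}{2}\,\mathrm{Tr}\bigl[(i[H,\rho])\,c_f(L_\rho,R_\rho)(i[H,\rho])\bigr],$$ where $L_\rho X=\rho X$ and $R_\rho X=X\rho$; it is $0$ if $f(0)=0$. Let $k\ge 1$. (1) For all finite-dimensional Hilbert spaces $\mathcal H_1,\dots,\mathcal H_k$, every density matrix $\rho_{1\dots k}$ on $\mathcal H_1\otimes\dots\otimes\mathcal H_k$ with reduced states $\rho_j$ on $\mathcal H_j$, and all Hermitian $H_j$ on $\mathcal H_j$, with $H_{1\dots k}=\sum_j H_j\otimes\mathbb I_{\bar j}$, where $\mathbb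 I_{\bar j}$ is the identity on the tensor factors other than $\mathcal H_j$, $$I^f(\rho_{1\dots k},H_{1\dots k})\ \ge\ \frac1k\sum_{j=1}^k I^f(\rho_j,H_j).$$ (2) If $f(0)>0$, then $\frac1k$ is the largest real constant $\beta$ such that $$I^f(\rho_{1\dots k},H_{1\dots k})\ \ge\ \beta\sum_{j=1}^k I^f(\rho_j,H_j)$$ holds for all finite-dimensional $\mathcal H_1,\dots,\mathcal H_k$ and all $\rho_{1\dots k}$ and $H_1,\dots,H_k$ as in (1). (3) In particular, for the Wigner–Yanase skew information $I^{WY}(\rho,H)=-\frac12\mathrm{Tr}([\sqrt\rho,H]^2)$, the largest real constant $\beta$ such that $I^{WY}(\rho_{1\dots k},H_{1\dots k})\ge\beta\sum_{j=1}^k I^{WY}(\rho_j,H_j)$ holds for all such systems, states and Hamiltonians is $\frac1k$; the case $k=2$ is the conjecture of Cai et al. -/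

import Mathlib

open scoped Kronecker ComplexOrder

noncomputable section

/-- Standard operator monotone functions `f : [0, ∞) → ℝ` (values at negative reals are irrelevant):
`0 ≤ A ≤ B` implies `f(A) ≤ f(B)` for Hermitian matrices of every size, `f(x) = x f(1/x)` for
`x > 0`, and `f(1) = 1`.  As usual, `f(0)` is the limit of `f(x)` as `x` decreases to `0`. -/
structure IsStandardOperatorMonotone (f : ℝ → ℝ) : Prop where
  monotone : ∀ (n : ℕ) (A B : Matrix (Fin n) (Fin n) ℂ),
    A.PosSemidef → (B - A).PosSemidef → (cfc f B - cfc f A).PosSemidef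
  symmetric : ∀ x : ℝ, 0 < x → f x = x * f (1 / x)
  normalized : f 1 = 1
  tendsto_zero : Filter.Tendsto f (nhdsWithin 0 (Set.Ioi 0)) (nhds (f 0))

/-- Quantum states of the finite-dimensional system with Hilbert space `ℂⁿ`: density matrices. -/
structure DensityMatrix (n : Type*) [Fintype n] where
  mat : Matrix n n ℂ
  posSemidef : mat.PosSemidef
  trace_eq_one : mat.trace = 1

/-- The Morozova-Chentsov function `c_f(x, y) = (y f(x / y))⁻¹` for `x, y ≥ 0`.  At `y = 0 < x` it
is the continuous extension `(x f(0))⁻¹`; its value at `(0, 0)` plays no role. -/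
def morozovaChentsov (f : ℝ → ℝ) (x y : ℝ) : ℝ :=
  if y = 0 then (x * f 0)⁻¹ else (y * f (x / y))⁻¹

/-- The superoperator `c(L_ρ, R_ρ)` for the commuting left and right multiplications `L_ρ` and
`R_ρ`: with `ρ = ∑ λ_i |i⟩⟨i|`, it multiplies the matrix element `⟨i| X |j⟩` by `c(λ_i, λ_j)`. -/
def leftRightCalculus {n : Type*} [Fintype n] [DecidableEq n] (c : ℝ → ℝ → ℝ)
    (ρ : DensityMatrix n) (X : Matrix n n ℂ) : Matrix n n ℂ :=
  let hρ := ρ.posSemidef.isHermitian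
  let U : Matrix n n ℂ := hρ.eigenvectorUnitary
  U * Matrix.of (fun i j => (c (hρ.eigenvalues i) (hρ.eigenvalues j) : ℂ) *
    (star U * X * U) i j) * star U

/-- The (metric-adjusted) skew information
`I^f(ρ, H) = (f(0) / 2) Tr[(i[H, ρ]) c_f(L_ρ, R_ρ)(i[H, ρ])]`. -/
def skewInformation {n : Type*} [Fintype n] [DecidableEq n] (f : ℝ → ℝ)
    (ρ : DensityMatrix n) (H : Matrix n n ℂ) : ℝ :=
  let K : Matrix n n ℂ := Complex.I • (H * ρ.mat - ρ.mat * H)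
  f 0 / 2 * (K * leftRightCalculus (morozovaChentsov f) ρ K).trace.re

/-- The Wigner-Yanase skew information `I^WY(ρ, H) = -(1/2) Tr([√ρ, H]²)`. -/
def wignerYanase {n : Type*} [Fintype n] [DecidableEq n]
    (ρ : DensityMatrix n) (H : Matrix n n ℂ) : ℝ :=
  -(1 / 2) * ((cfc Real.sqrt ρ.mat * H - H * cfc Real.sqrt ρ.mat) ^ 2).trace.re

/-- The reduced state `ρ_j` on the `j`th subsystem: the partial trace over all the others.  The
`k`-partite system has Hilbert space `⨂_j ℂ^(ι j)`, with basis indexed by `∀ j, ι j`. -/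
def reducedState {k : ℕ} {ι : Fin k → Type*} [∀ j, Fintype (ι j)]
    (ρ : DensityMatrix (∀ j, ι j)) (j : Fin k) : DensityMatrix (ι j) where
  mat := Matrix.of fun a b => ∑ y : (∀ i : {i // i ≠ j}, ι i),
    ρ.mat ((Equiv.piSplitAt j ι).symm (a, y)) ((Equiv.piSplitAt j ι).symm (b, y))
  posSemidef := by
    have h : (Matrix.of fun a b => ∑ y : (∀ i : {i // i ≠ j}, ι i),
        ρ.mat ((Equiv.piSplitAt j ι).symm (a, y)) ((Equiv.piSplitAt j ι).symm (b, y))) =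
        ∑ y : (∀ i : {i // i ≠ j}, ι i),
          ρ.mat.submatrix (fun a => (Equiv.piSplitAt j ι).symm (a, y))
            (fun a => (Equiv.piSplitAt j ι).symm (a, y)) := by
      ext a b
      simp [Matrix.sum_apply]
    rw [h]
    exact Matrix.posSemidef_sum _ fun y _ => ρ.posSemidef.submatrix _
  trace_eq_one := by
    rw [← ρ.trace_eq_one]
    simp only [Matrix.trace, Matrix.diag_apply, Matrix.of_apply]
    rw [← Fintype.sum_prod_type']
    exact Equiv.sum_comp (Equiv.piSplitAt j ι).symm fun x => ρ.mat x x

/-- The additive Hamiltonian `∑_j H_j ⊗ 𝕀_{j̄}`. -/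
def additiveHamiltonian {k : ℕ} {ι : Fin k → Type*} [∀ j, Fintype (ι j)]
    [∀ j, DecidableEq (ι j)] (H : ∀ j, Matrix (ι j) (ι j) ℂ) :
    Matrix (∀ j, ι j) (∀ j, ι j) ℂ :=
  ∑ j, (H j ⊗ₖ (1 : Matrix (∀ i : {i // i ≠ j}, ι i) (∀ i : {i // i ≠ j}, ι i) ℂ)).submatrix
    (Equiv.piSplitAt j ι) (Equiv.piSplitAt j ι)

end

/-! The lower bound is monotonicity of the metric under partial trace. In the eigenbasis of `ρ`,
with `K = i[H, ρ]`, the skew information is `f(0)/2 · ∑ c_f(λ_i, λ_j) |K_ij|²`. The partial trace is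
dual to the `*`-homomorphism `A ↦ A ⊗ 𝕀`. It sends `i[H_{1…k}, ρ]` to `i[H_j, ρ_j]`, because the
other terms of the Hamiltonian commute with `A ⊗ 𝕀`. Hence each `I^f(ρ_j, H_j)` is at most `I^f(ρ,
H_{1…k})`, and averaging over `j` gives the factor `1/k`.

Monotonicity itself (`sum_morozovaChentsov_le`) comes from operator monotonicity. A pinching
argument gives Hansen's inequality, a change of variables turns it into the transformer inequality
for the mean `m_f(x, y) = y f(x/y)`, and Cauchy–Schwarz dualizes that to the inverse weights `c_f =
1/m_f`.

For optimality, each subsystem is a ladder with levels `0, …, d`, and the joint state mixes the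
phase states `∑_x exp(i s l(x)) |x⟩`, `l` the total energy, with density `1 + ε cos s`. Every
reduced state is the same mixture on one ladder, so all the clocks record the same phase and jointly
know no more about it than its density allows. Quantitatively, `harmonic ≤ m_f ≤ max` bounds the
joint information above by `f(0)/2 · ε²/(2(1-ε))`, whatever `k` is, and each local one below by the
same leading term times `d/((d+1)(1+ε))`. Taking `ε = 1/(d+1)` and `d` large forces `β k ≤ 1`.

The Wigner–Yanase case is `f(x) = ((1+√x)/2)²`, with `f(0) = 1/4`. -/

open scoped Matrix Kronecker ComplexOrder

/-! ### Functional calculus of matrices by polynomial interpolation. -/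

section FunctionalCalculus

open Polynomial in
/-- On finitely many Hermitian matrices a function agrees with a polynomial. -/
theorem exists_polynomial_eq_on (s : Set ℝ) (hs : s.Finite) (f : ℝ → ℝ) :
    ∃ q : ℝ[X], ∀ x ∈ s, f x = q.eval x := by
  classical
  refine ⟨Lagrange.interpolate hs.toFinset id f, fun x hx => ?_⟩
  have := Lagrange.eval_interpolate_at_node (s := hs.toFinset) (v := id) f
    Function.injective_id.injOn (hs.mem_toFinset.2 hx)
  simpa using this.symm

theorem cfc_eq_aeval_of_eqOn {n : Type*} [Fintype n] [DecidableEq n] {A : Matrix n n ℂ}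
    (hA : A.IsHermitian) {f : ℝ → ℝ} {q : Polynomial ℝ} (h : ∀ x ∈ spectrum ℝ A, f x = q.eval x) :
    cfc f A = Polynomial.aeval A q := by
  rw [← cfc_polynomial q A hA.isSelfAdjoint]
  exact cfc_congr h

theorem aeval_mul_eq_mul_aeval {m n : Type*} [Fintype m] [DecidableEq m] [Fintype n]
    [DecidableEq n] {A : Matrix m m ℂ} {B : Matrix n n ℂ} {C : Matrix m n ℂ} (h : A * C = C * B)
    (q : Polynomial ℝ) : Polynomial.aeval A q * C = C * Polynomial.aeval B q := by
  have hpow : ∀ k : ℕ, A ^ k * C = C * B ^ k := by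
    intro k
    induction k with
    | zero => simp
    | succ k ih => rw [pow_succ, pow_succ', Matrix.mul_assoc, h, ← Matrix.mul_assoc, ih,
        Matrix.mul_assoc, ← pow_succ, ← pow_succ']
  induction q using Polynomial.induction_on' with
  | add p q hp hq => simp [Matrix.add_mul, Matrix.mul_add, hp, hq]
  | monomial k a =>
    simp [Polynomial.aeval_monomial, Algebra.algebraMap_eq_smul_one, hpow]

/-- The functional calculus respects intertwining matrices. -/
theorem cfc_mul_eq_mul_cfc {m n : Type*} [Fintype m] [DecidableEq m] [Fintype n]
    [DecidableEq n] {A : Matrix m m ℂ} {B : Matrix n n ℂ} (hA : A.IsHermitian)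
    (hB : B.IsHermitian) {C : Matrix m n ℂ} (h : A * C = C * B) (f : ℝ → ℝ) :
    cfc f A * C = C * cfc f B := by
  obtain ⟨q, hq⟩ := exists_polynomial_eq_on (spectrum ℝ A ∪ spectrum ℝ B)
    (A.finite_real_spectrum.union B.finite_real_spectrum) f
  rw [cfc_eq_aeval_of_eqOn hA fun x hx => hq x (Or.inl hx),
    cfc_eq_aeval_of_eqOn hB fun x hx => hq x (Or.inr hx)]
  exact aeval_mul_eq_mul_aeval h q

theorem isHermitian_diagonal_ofReal {n : Type*} [DecidableEq n] (d : n → ℝ) :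
    (Matrix.diagonal fun i => (d i : ℂ)).IsHermitian := by
  refine Matrix.isHermitian_diagonal_of_self_adjoint _ ?_
  ext i
  simp

theorem cfc_diagonal {n : Type*} [Fintype n] [DecidableEq n] (f : ℝ → ℝ) (d : n → ℝ) :
    cfc f (Matrix.diagonal fun i => (d i : ℂ)) = Matrix.diagonal fun i => (f (d i) : ℂ) := by
  -- Interpolating on the diagonal entries as well as on the spectrum avoids having to identify the
  -- two sets.
  obtain ⟨q, hq⟩ := exists_polynomial_eq_on
    (spectrum ℝ (Matrix.diagonal fun i => (d i : ℂ)) ∪ Set.range d)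
    (Matrix.finite_real_spectrum.union (Set.finite_range d)) f
  rw [cfc_eq_aeval_of_eqOn (isHermitian_diagonal_ofReal d) fun x hx => hq x (Or.inl hx)]
  have := Polynomial.aeval_algHom_apply (Matrix.diagonalAlgHom (n := n) (α := ℂ) ℝ)
    (fun i => (d i : ℂ)) q
  simp only [Matrix.diagonalAlgHom_apply] at this
  rw [this]
  congr 1
  ext i
  have h2 := Polynomial.aeval_algHom_apply (Pi.evalAlgHom ℝ (fun _ : n => ℂ) i)
    (fun i => (d i : ℂ)) q
  simp only [Pi.evalAlgHom_apply] at h2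
  rw [← h2, hq (d i) (Or.inr ⟨i, rfl⟩), ← Complex.coe_algebraMap,
    Polynomial.aeval_algebraMap_apply]
  simp

end FunctionalCalculus

/-! ### Scalar properties of standard operator monotone functions. -/

namespace IsStandardOperatorMonotone

variable {f : ℝ → ℝ} (hf : IsStandardOperatorMonotone f)

include hf

theorem le_of_le {x y : ℝ} (hx : 0 ≤ x) (hxy : x ≤ y) : f x ≤ f y := by
  have h := hf.monotone 1 (Matrix.diagonal fun _ => (x : ℂ)) (Matrix.diagonal fun _ => (y : ℂ))
    (Matrix.PosSemidef.diagonal fun _ => by simpa using hx) (by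
      rw [Matrix.diagonal_sub]
      exact Matrix.PosSemidef.diagonal fun _ => by simpa [← Complex.ofReal_sub] using hxy)
  rw [cfc_diagonal f fun _ : Fin 1 => x, cfc_diagonal f fun _ : Fin 1 => y,
    Matrix.diagonal_sub, Matrix.posSemidef_diagonal_iff] at h
  simpa [← Complex.ofReal_sub] using h 0

theorem self_le {x : ℝ} (hx : 0 < x) (hx1 : x ≤ 1) : x ≤ f x := by
  rw [hf.symmetric x hx]
  have := hf.le_of_le zero_le_one ((one_le_div hx).2 hx1)
  rw [hf.normalized] at this
  nlinarith

theorem pos {x : ℝ} (hx : 0 < x) : 0 < f x := by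
  rcases le_total x 1 with h | h
  · exact hx.trans_le (hf.self_le hx h)
  · have := hf.le_of_le zero_le_one h
    rw [hf.normalized] at this
    linarith

theorem zero_nonneg : 0 ≤ f 0 :=
  ge_of_tendsto hf.tendsto_zero (Filter.eventually_of_mem self_mem_nhdsWithin fun _ hx =>
    (hf.pos hx).le)

theorem nonneg {x : ℝ} (hx : 0 ≤ x) : 0 ≤ f x :=
  hf.zero_nonneg.trans (hf.le_of_le le_rfl hx)

theorem le_max {x : ℝ} (hx : 0 ≤ x) : f x ≤ max 1 x := by
  rcases le_total x 1 with h | h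
  · have := hf.le_of_le hx h
    rw [hf.normalized] at this
    exact this.trans (le_max_left _ _)
  · have h0 : 0 < x := by linarith
    rw [hf.symmetric x h0]
    have := hf.le_of_le (by positivity) ((div_le_one h0).2 h)
    rw [hf.normalized] at this
    exact le_trans (by nlinarith) (le_max_right _ _)

/-- By symmetry `f(x)/x = f(1/x)`, which decreases in `x`. This replaces concavity throughout. -/
theorem map_mul_le {c x : ℝ} (hc : 1 ≤ c) (hx : 0 ≤ x) : f (c * x) ≤ c * f x := by
  rcases hx.eq_or_lt with rfl | hx
  · have := hf.zero_nonneg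
    simp only [mul_zero]
    nlinarith
  · have hcx : 0 < c * x := by positivity
    rw [hf.symmetric _ hcx, hf.symmetric _ hx, mul_assoc]
    have : f (1 / (c * x)) ≤ f (1 / x) := hf.le_of_le (by positivity)
      (one_div_le_one_div_of_le hx (by nlinarith))
    gcongr

/-- Since `f` increases and `f(x)/x` decreases, `f y` lies between `min 1 (y/x) * f x` and `max 1
(y/x) * f x`. At `0` continuity is the normalization of `f 0`. -/
theorem continuousOn : ContinuousOn f (Set.Ici 0) := by
  intro x hx
  rcases (Set.mem_Ici.1 hx).eq_or_lt with rfl | hx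
  · rw [← Set.Ioi_insert, continuousWithinAt_insert_self]
    exact hf.tendsto_zero
  · refine ContinuousAt.continuousWithinAt ?_
    have hdiv : Filter.Tendsto (fun y => y / x) (nhds x) (nhds 1) := by
      have : Filter.Tendsto (fun y => y / x) (nhds x) (nhds (x / x)) :=
        (continuous_id.div_const x).tendsto x
      rwa [div_self hx.ne'] at this
    have hlow : Filter.Tendsto (fun y => min 1 (y / x) * f x) (nhds x) (nhds (f x)) := by
      simpa using ((tendsto_const_nhds (x := (1 : ℝ))).min hdiv).mul_const (f x)
    have hup : Filter.Tendsto (fun y => max 1 (y / x) * f x) (nhds x) (nhds (f x)) := by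
      simpa using ((tendsto_const_nhds (x := (1 : ℝ))).max hdiv).mul_const (f x)
    have hfx := hf.pos hx
    refine tendsto_of_tendsto_of_tendsto_of_le_of_le' hlow hup ?_ ?_ <;>
      filter_upwards [Ioi_mem_nhds hx] with y hy <;> rw [Set.mem_Ioi] at hy
    · rcases le_total x y with h | h
      · exact (mul_le_of_le_one_left hfx.le (min_le_left _ _)).trans (hf.le_of_le hx.le h)
      · have := hf.map_mul_le ((one_le_div hy).2 h) hy.le
        rw [div_mul_cancel₀ _ hy.ne'] at this
        calc min 1 (y / x) * f x ≤ y / x * f x := by gcongr; exact min_le_right _ _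
          _ ≤ y / x * (x / y * f y) := by gcongr
          _ = f y := by field_simp
    · rcases le_total x y with h | h
      · have := hf.map_mul_le ((one_le_div hx).2 h) hx.le
        rw [div_mul_cancel₀ _ hx.ne'] at this
        exact this.trans (by gcongr; exact le_max_right _ _)
      · exact (hf.le_of_le hy.le h).trans (le_mul_of_one_le_left hfx.le (le_max_left _ _))

/-- The harmonic function is the smallest standard operator monotone function. -/
theorem harmonic_le {t : ℝ} (ht : 0 < t) : 2 * t / (1 + t) ≤ f t := by
  set s := √t with hs
  set r := √(1 + t) with hr
  have hs0 : 0 < s := Real.sqrt_pos.2 ht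
  have hr0 : 0 < r := Real.sqrt_pos.2 (by linarith)
  have hs2 : s ^ 2 = t := Real.sq_sqrt ht.le
  have hr2 : r ^ 2 = 1 + s ^ 2 := by rw [hs2]; exact Real.sq_sqrt (by linarith)
  -- The projection `A` onto `v = (1, √t)/√(1+t)` lies below `B = diag(1/t, t)`, and `B - A` has
  -- rank one. As `f(A) ≥ 0` fixes `v`, also `A ≤ f(A) ≤ f(B)`. The bound is then `det (f(B) - A) ≥
  -- 0`.
  let v : Fin 2 → ℂ := ![((1 / r : ℝ) : ℂ), ((s / r : ℝ) : ℂ)]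
  let z : Fin 2 → ℂ := ![((1 / (s * r) : ℝ) : ℂ), ((-s ^ 2 / r : ℝ) : ℂ)]
  let b : Fin 2 → ℝ := ![1 / t, t]
  set A := Matrix.vecMulVec v (star v) with hA
  have hApos : A.PosSemidef := Matrix.posSemidef_vecMulVec_self_star v
  have hBA : (Matrix.diagonal (fun i => (b i : ℂ))) - A = Matrix.vecMulVec z (star z) := by
    have h1 : 1 / t - 1 / r * (1 / r) = 1 / (s * r) * (1 / (s * r)) := by
      rw [← hs2]
      field_simp
      linear_combination hr2
    have h2 : t - s / r * (s / r) = -s ^ 2 / r * (-s ^ 2 / r) := by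
      rw [← hs2]
      field_simp
      linear_combination hr2
    have h3 : -(1 / r * (s / r)) = 1 / (s * r) * (-s ^ 2 / r) := by
      field_simp
    ext i j
    fin_cases i <;> fin_cases j <;>
      simp only [hA, v, z, b, Matrix.sub_apply, Matrix.vecMulVec_apply, Matrix.diagonal_apply,
        Pi.star_apply, Fin.zero_eta, Fin.mk_one, Fin.isValue, Matrix.cons_val_zero,
        Matrix.cons_val_one, if_true, if_false, one_ne_zero, zero_ne_one, RCLike.star_def,
        Complex.conj_ofReal, ← Complex.ofReal_mul, ← Complex.ofReal_sub, zero_sub,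
        ← Complex.ofReal_neg, Complex.ofReal_inj]
    · exact h1
    · exact h3
    · linear_combination h3
    · exact h2
  have hvv : star v ⬝ᵥ v = 1 := by
    have : 1 / r * (1 / r) + s / r * (s / r) = 1 := by
      field_simp
      linear_combination -hr2
    simp only [dotProduct, Fin.sum_univ_two, v, Pi.star_apply, Matrix.cons_val_zero,
      Matrix.cons_val_one, RCLike.star_def, Complex.conj_ofReal, ← Complex.ofReal_mul,
      ← Complex.ofReal_add, this, Complex.ofReal_one]
  set F := cfc f A with hF
  have hFpos : F.PosSemidef := by
    have h := hf.monotone 2 (Matrix.diagonal fun _ => ((0 : ℝ) : ℂ)) A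
      (Matrix.PosSemidef.diagonal fun _ => by simp) (by simpa using hApos)
    rw [cfc_diagonal f fun _ : Fin 2 => (0 : ℝ)] at h
    have h2 : (Matrix.diagonal fun _ : Fin 2 => (f 0 : ℂ)).PosSemidef :=
      Matrix.PosSemidef.diagonal fun _ => by simpa using hf.zero_nonneg
    simpa using h.add h2
  have hFv : F *ᵥ v = v := by
    have h := cfc_mul_eq_mul_cfc hApos.1 (isHermitian_diagonal_ofReal fun _ : Unit => (1 : ℝ))
      (C := Matrix.replicateCol Unit v) (by
        ext i j
        simp [hA, ← Matrix.replicateCol_mulVec, Matrix.vecMulVec_mulVec, hvv]) f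
    rw [cfc_diagonal, hf.normalized] at h
    ext i
    have := congrFun (congrFun h i) ()
    simpa [← Matrix.replicateCol_mulVec] using this
  have hvF : star v ᵥ* F = star v := by
    have := congrArg star hFv
    rwa [Matrix.star_mulVec, hFpos.1.eq] at this
  -- `F` and `A` agree on `v`, so `F - A` is the compression of `F ≥ 0` to the complement of `v`.
  have hFA : (F - A).PosSemidef := by
    have h := hFpos.conjTranspose_mul_mul_same (1 - A)
    have e : (1 - A)ᴴ * F * (1 - A) = F - A := by
      have h1 : A * F = A := by rw [hA, Matrix.vecMulVec_mul, hvF]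
      have h2 : F * A = A := by rw [hA, Matrix.mul_vecMulVec, hFv]
      have h3 : A * A = A := by
        rw [hA, Matrix.vecMulVec_mul_vecMulVec, hvv, one_smul]
      rw [Matrix.conjTranspose_sub, hApos.1.eq, Matrix.conjTranspose_one, Matrix.sub_mul,
        Matrix.one_mul, h1, Matrix.mul_sub, Matrix.mul_one, Matrix.sub_mul, h2, h3]
      abel
    rwa [e] at h
  have hBF := hf.monotone 2 A _ hApos (by
    rw [hBA]; exact Matrix.posSemidef_vecMulVec_self_star z)
  have hdet := (hBF.add hFA).det_nonneg
  rw [sub_add_sub_cancel, cfc_diagonal, Matrix.det_fin_two] at hdet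
  have h1t : f (1 / t) = f t / t := by
    rw [hf.symmetric t ht]
    field_simp
  simp only [hA, v, b, Matrix.sub_apply, Matrix.vecMulVec_apply, Matrix.diagonal_apply,
        Pi.star_apply, Fin.isValue, Matrix.cons_val_zero,
        Matrix.cons_val_one, if_true, if_false, one_ne_zero, zero_ne_one, RCLike.star_def,
        Complex.conj_ofReal, ← Complex.ofReal_mul, ← Complex.ofReal_sub, zero_sub,
        ← Complex.ofReal_neg, Complex.zero_le_real, h1t] at hdet
  have hft := hf.pos ht
  have e : (f t / t - 1 / r * (1 / r)) * (f t - s / r * (s / r)) -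
      -(1 / r * (s / r)) * -(s / r * (1 / r)) = f t / t * (f t - 2 * t / (1 + t)) := by
    have : r ^ 2 = 1 + t := by rw [hr2, hs2]
    rw [← this, ← hs2]
    field_simp
    ring
  rw [e] at hdet
  have : 0 < f t / t := by positivity
  nlinarith [nonneg_of_mul_nonneg_right hdet this]

end IsStandardOperatorMonotone

/-! ### Quadratic forms of diagonal matrices. -/

section DiagonalForms

variable {m n : Type*} [Fintype m] [DecidableEq m] [Fintype n]

theorem star_dotProduct_diagonal_mulVec [DecidableEq n] (d : n → ℝ) (x : n → ℂ) :
    star x ⬝ᵥ ((Matrix.diagonal fun i => (d i : ℂ)) *ᵥ x) = ((∑ i, d i * ‖x i‖ ^ 2 : ℝ) : ℂ) := by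
  simp only [dotProduct, Matrix.mulVec_diagonal, Complex.ofReal_sum, Pi.star_apply]
  refine Finset.sum_congr rfl fun i _ => ?_
  rw [Complex.ofReal_mul, Complex.ofReal_pow, ← Complex.conj_mul', RCLike.star_def]
  ring

theorem star_dotProduct_conjTranspose_mul_diagonal_mul_mulVec (d : m → ℝ) (C : Matrix m n ℂ)
    (x : n → ℂ) :
    star x ⬝ᵥ ((Cᴴ * (Matrix.diagonal fun i => (d i : ℂ)) * C) *ᵥ x) =
      ((∑ i, d i * ‖(C *ᵥ x) i‖ ^ 2 : ℝ) : ℂ) := by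
  rw [← star_dotProduct_diagonal_mulVec, Matrix.star_mulVec, ← Matrix.mulVec_mulVec,
    ← Matrix.mulVec_mulVec, Matrix.dotProduct_mulVec]

theorem sum_le_sum_of_posSemidef_diagonal_sub [DecidableEq n] {α : n → ℝ} {β : m → ℝ}
    {C : Matrix m n ℂ}
    (h : ((Matrix.diagonal fun i => (α i : ℂ)) -
      Cᴴ * (Matrix.diagonal fun i => (β i : ℂ)) * C).PosSemidef) (x : n → ℂ) :
    ∑ i, β i * ‖(C *ᵥ x) i‖ ^ 2 ≤ ∑ i, α i * ‖x i‖ ^ 2 := by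
  have := h.dotProduct_mulVec_nonneg x
  rw [Matrix.sub_mulVec, dotProduct_sub, star_dotProduct_diagonal_mulVec,
    star_dotProduct_conjTranspose_mul_diagonal_mul_mulVec, ← Complex.ofReal_sub,
    Complex.zero_le_real] at this
  linarith

end DiagonalForms

/-! ### Hansen's inequality and the transformer inequality. -/

section Hansen

variable {m n : Type*} [Fintype m] [DecidableEq m] [Fintype n] [DecidableEq n]

/-- A positive operator is dominated, up to a factor, by its block diagonal part. -/
theorem posSemidef_pinching_sub {D P : Matrix m m ℂ} (hD : D.PosSemidef) {t : ℝ}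
    (hDt : ((t : ℂ) • (1 : Matrix m m ℂ) - D).PosSemidef) (hP : P.IsHermitian) (hPP : P * P = P)
    {s : ℝ} (hs : 0 < s) :
    ((1 + s ^ 2 : ℂ) • (P * D * P) + ((1 + (s⁻¹) ^ 2) * t : ℂ) • (1 - P) - D).PosSemidef := by
  have hQ : (1 - P)ᴴ = 1 - P := by rw [Matrix.conjTranspose_sub, hP.eq, Matrix.conjTranspose_one]
  -- With `Q = 1 - P`, expanding this conjugation bounds the cross terms `PDQ + QDP` by `s² PDP +
  -- s⁻² QDQ`; `h2` then replaces `QDQ` by `t Q`.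
  have h1 := hD.conjTranspose_mul_mul_same ((s : ℂ) • P - (s⁻¹ : ℂ) • (1 - P))
  have h2 := (hDt.conjTranspose_mul_mul_same (1 - P)).smul
    (show (0 : ℂ) ≤ ((1 + (s⁻¹) ^ 2 : ℝ) : ℂ) by
      rw [Complex.zero_le_real]; positivity)
  have h := h1.add h2
  convert h using 1
  have hs' : (s : ℂ) ≠ 0 := by exact_mod_cast hs.ne'
  have e : ((s : ℂ) • P - (s⁻¹ : ℂ) • (1 - P))ᴴ = (s : ℂ) • P - (s⁻¹ : ℂ) • (1 - P) := by
    rw [Matrix.conjTranspose_sub, Matrix.conjTranspose_smul, Matrix.conjTranspose_smul, hQ, hP.eq]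
    simp
  rw [e, hQ]
  have e2 : (1 - P) * (1 - P) = 1 - P := (IsIdempotentElem.one_sub hPP).eq
  have e3 : (1 - P) * ((t : ℂ) • (1 : Matrix m m ℂ) - D) * (1 - P) =
      (t : ℂ) • (1 - P) - (1 - P) * D * (1 - P) := by
    have : (1 - P) * ((t : ℂ) • (1 : Matrix m m ℂ) - D) = (t : ℂ) • (1 - P) - (1 - P) * D := by
      rw [Matrix.mul_sub, Matrix.mul_smul, Matrix.mul_one]
    rw [this, Matrix.sub_mul, Matrix.smul_mul, e2]
  rw [e3]
  simp only [Matrix.mul_sub, Matrix.sub_mul, Matrix.smul_mul, Matrix.mul_smul, Matrix.mul_one,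
    Matrix.one_mul, Complex.ofReal_add, Complex.ofReal_one, Complex.ofReal_pow, Complex.ofReal_inv]
  match_scalars <;> field_simp <;> ring

variable {f : ℝ → ℝ}

/-- Hansen's inequality up to the factor `1 + s²`. The pinched bound `E ≥ D` for `P = C Cᴴ` leaves
the range of `C` invariant and acts there as `(1 + s²) g`. So compressing `f(D) ≤ f(E)` by `C` gives
`f((1 + s²) g) ≤ (1 + s²) f(g)` on the right. -/
theorem IsStandardOperatorMonotone.posSemidef_compression (hf : IsStandardOperatorMonotone f)
    {k : ℕ} {C : Matrix (Fin k) n ℂ} (hC : Cᴴ * C = 1) {d : Fin k → ℝ} {g : n → ℝ}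
    (hd : ∀ i, 0 ≤ d i) (hg : ∀ i, 0 ≤ g i)
    (hCd : Cᴴ * (Matrix.diagonal fun i => (d i : ℂ)) * C = Matrix.diagonal fun i => (g i : ℂ))
    {s : ℝ} (hs : 0 < s) :
    ((Matrix.diagonal fun i => (((1 + s ^ 2) * f (g i) : ℝ) : ℂ)) -
      Cᴴ * (Matrix.diagonal fun i => (f (d i) : ℂ)) * C).PosSemidef := by
  set D : Matrix (Fin k) (Fin k) ℂ := Matrix.diagonal fun i => (d i : ℂ) with hDdef
  have hD : D.PosSemidef := Matrix.PosSemidef.diagonal fun i => by simpa using hd i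
  -- Any upper bound for `D` serves: its coefficient multiplies `1 - C Cᴴ`, which `C` annihilates.
  have hDt : (((∑ i, d i : ℝ) : ℂ) • (1 : Matrix (Fin k) (Fin k) ℂ) - D).PosSemidef := by
    rw [Matrix.smul_one_eq_diagonal, hDdef, Matrix.diagonal_sub]
    refine Matrix.PosSemidef.diagonal fun i => ?_
    rw [← Complex.ofReal_sub, Pi.zero_apply, Complex.zero_le_real, sub_nonneg]
    exact Finset.single_le_sum (fun j _ => hd j) (Finset.mem_univ i)
  have hP : (C * Cᴴ).IsHermitian := Matrix.isHermitian_mul_conjTranspose_self C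
  have hPP : C * Cᴴ * (C * Cᴴ) = C * Cᴴ := by
    rw [Matrix.mul_assoc, ← Matrix.mul_assoc Cᴴ, hC, Matrix.one_mul]
  have hE := posSemidef_pinching_sub hD hDt hP hPP hs
  set E := (1 + s ^ 2 : ℂ) • (C * Cᴴ * D * (C * Cᴴ)) +
    ((1 + (s⁻¹) ^ 2) * (∑ i, d i : ℝ) : ℂ) • (1 - C * Cᴴ) with hEdef
  have hEC : E * C = C * Matrix.diagonal fun i => (((1 + s ^ 2) * g i : ℝ) : ℂ) := by
    have e1 : (C * Cᴴ * D * (C * Cᴴ)) * C = C * Matrix.diagonal fun i => (g i : ℂ) := by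
      rw [← hCd]
      simp only [Matrix.mul_assoc, hC, Matrix.mul_one]
    have e2 : (1 - C * Cᴴ) * C = 0 := by
      rw [Matrix.sub_mul, Matrix.mul_assoc, hC, Matrix.one_mul, Matrix.mul_one, sub_self]
    rw [hEdef, Matrix.add_mul, Matrix.smul_mul, Matrix.smul_mul, e1, e2, smul_zero, add_zero,
      ← Matrix.mul_smul, ← Matrix.diagonal_smul]
    congr 2
    ext i
    simp
  have hEherm : E.IsHermitian := by
    have := hE.1.add hD.1
    rwa [sub_add_cancel] at this
  have h1 := (hf.monotone k D E hD hE).conjTranspose_mul_mul_same C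
  rw [Matrix.mul_sub, Matrix.sub_mul, Matrix.mul_assoc,
    cfc_mul_eq_mul_cfc hEherm (isHermitian_diagonal_ofReal _) hEC, ← Matrix.mul_assoc, hC,
    Matrix.one_mul, cfc_diagonal, hDdef, cfc_diagonal] at h1
  have h2 : (Matrix.diagonal fun i =>
      (((1 + s ^ 2) * f (g i) - f ((1 + s ^ 2) * g i) : ℝ) : ℂ)).PosSemidef :=
    Matrix.PosSemidef.diagonal fun i => by
      have := hf.map_mul_le (show 1 ≤ 1 + s ^ 2 by nlinarith) (hg i)
      simpa only [Pi.zero_apply, Complex.zero_le_real, sub_nonneg] using this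
  convert h2.add h1 using 1
  rw [← add_sub_assoc, Matrix.diagonal_add]
  congr 2
  ext i
  rw [← Complex.ofReal_add, sub_add_cancel]

/-- **Hansen's inequality** `Cᴴ f(D) C ≤ f(Cᴴ D C)` for an isometry `C`, with both `D` and
`Cᴴ D C` diagonal. -/
theorem IsStandardOperatorMonotone.sum_compression_le (hf : IsStandardOperatorMonotone f)
    {C : Matrix m n ℂ} (hC : Cᴴ * C = 1) {d : m → ℝ} {g : n → ℝ}
    (hd : ∀ i, 0 ≤ d i) (hg : ∀ i, 0 ≤ g i)
    (hCd : Cᴴ * (Matrix.diagonal fun i => (d i : ℂ)) * C = Matrix.diagonal fun i => (g i : ℂ))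
    (x : n → ℂ) :
    ∑ i, f (d i) * ‖(C *ᵥ x) i‖ ^ 2 ≤ ∑ i, f (g i) * ‖x i‖ ^ 2 := by
  -- Operator monotonicity is assumed for `Fin`-indexed matrices only, hence the reindexing. The
  -- loss `1 + s²` disappears as `s → 0`.
  let e := Fintype.equivFin m
  have hC' : (C.submatrix e.symm id)ᴴ * C.submatrix e.symm id = 1 := by
    rw [Matrix.conjTranspose_submatrix, Matrix.submatrix_mul_equiv, hC, Matrix.submatrix_id_id]
  have hCd' : (C.submatrix e.symm id)ᴴ * (Matrix.diagonal fun i => (d (e.symm i) : ℂ)) *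
      C.submatrix e.symm id = Matrix.diagonal fun i => (g i : ℂ) := by
    have : (Matrix.diagonal fun i => (d (e.symm i) : ℂ)) =
        (Matrix.diagonal fun i => (d i : ℂ)).submatrix e.symm e.symm :=
      (Matrix.submatrix_diagonal_equiv (fun i => (d i : ℂ)) e.symm).symm
    rw [this, Matrix.conjTranspose_submatrix, Matrix.submatrix_mul_equiv,
      Matrix.submatrix_mul_equiv, hCd, Matrix.submatrix_id_id]
  have key : ∀ s : ℝ, 0 < s → ∑ i, f (d i) * ‖(C *ᵥ x) i‖ ^ 2 ≤
      (1 + s ^ 2) * ∑ i, f (g i) * ‖x i‖ ^ 2 := by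
    intro s hs
    have h := sum_le_sum_of_posSemidef_diagonal_sub
      (hf.posSemidef_compression hC' (fun i => hd (e.symm i)) hg hCd' hs) x
    rw [Finset.mul_sum, ← Equiv.sum_comp e.symm]
    have hx : ∀ i, (C.submatrix e.symm id *ᵥ x) i = (C *ᵥ x) (e.symm i) := fun i => rfl
    simpa only [mul_assoc, hx] using h
  have hlim : Filter.Tendsto (fun s : ℝ => (1 + s ^ 2) * ∑ i, f (g i) * ‖x i‖ ^ 2)
      (nhdsWithin 0 (Set.Ioi 0)) (nhds (∑ i, f (g i) * ‖x i‖ ^ 2)) := by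
    have : Continuous fun s : ℝ => (1 + s ^ 2) * ∑ i, f (g i) * ‖x i‖ ^ 2 := by fun_prop
    have := (this.tendsto 0).mono_left (nhdsWithin_le_nhds (s := Set.Ioi 0))
    simpa using this
  exact ge_of_tendsto hlim (Filter.eventually_of_mem self_mem_nhdsWithin key)

/-- The transformer inequality `Vᴴ m_f(a, b) V ≤ m_f(Vᴴ a V, Vᴴ b V)` for the operator mean
`m_f` of simultaneously diagonal matrices. -/
theorem IsStandardOperatorMonotone.sum_transformer_le (hf : IsStandardOperatorMonotone f)
    {V : Matrix m n ℂ} {a b : m → ℝ} {a' b' : n → ℝ} (ha : ∀ i, 0 ≤ a i) (hb : ∀ i, 0 < b i)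
    (ha' : ∀ i, 0 ≤ a' i) (hb' : ∀ i, 0 < b' i)
    (hVa : Vᴴ * (Matrix.diagonal fun i => (a i : ℂ)) * V = Matrix.diagonal fun i => (a' i : ℂ))
    (hVb : Vᴴ * (Matrix.diagonal fun i => (b i : ℂ)) * V = Matrix.diagonal fun i => (b' i : ℂ))
    (x : n → ℂ) :
    ∑ i, b i * f (a i / b i) * ‖(V *ᵥ x) i‖ ^ 2 ≤ ∑ i, b' i * f (a' i / b' i) * ‖x i‖ ^ 2 := by
  set B : Matrix m m ℂ := Matrix.diagonal fun i => ((√(b i) : ℝ) : ℂ) with hB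
  set B' : Matrix n n ℂ := Matrix.diagonal fun i => (((√(b' i))⁻¹ : ℝ) : ℂ) with hB'
  have hBH : Bᴴ = B := (isHermitian_diagonal_ofReal _).eq
  have hB'H : B'ᴴ = B' := (isHermitian_diagonal_ofReal _).eq
  have hsb : ∀ i, √(b i) * √(b i) = b i := fun i => Real.mul_self_sqrt (hb i).le
  have hsb' : ∀ i, √(b' i) * √(b' i) = b' i := fun i => Real.mul_self_sqrt (hb' i).le
  have hsb0 : ∀ i, √(b i) ≠ 0 := fun i => (Real.sqrt_pos.2 (hb i)).ne'
  have hsb0' : ∀ i, √(b' i) ≠ 0 := fun i => (Real.sqrt_pos.2 (hb' i)).ne'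
  -- `C = b^{1/2} V b'^{-1/2}` is an isometry that compresses `a/b` to `a'/b'`. Hansen's inequality
  -- for `C`, at the vector `b'^{1/2} x`, is the claim.
  have hC : (B * V * B')ᴴ * (B * V * B') = 1 := by
    have e1 : B * B = Matrix.diagonal fun i => (b i : ℂ) := by
      rw [hB, Matrix.diagonal_mul_diagonal]
      congr 1
      ext i
      rw [← Complex.ofReal_mul, hsb]
    calc (B * V * B')ᴴ * (B * V * B') = B' * (Vᴴ * (B * B) * V) * B' := by
          rw [Matrix.conjTranspose_mul, Matrix.conjTranspose_mul, hBH, hB'H]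
          simp only [Matrix.mul_assoc]
      _ = 1 := by
          rw [e1, hVb, hB', Matrix.diagonal_mul_diagonal, Matrix.diagonal_mul_diagonal,
            ← Matrix.diagonal_one]
          congr 1
          ext i
          rw [← Complex.ofReal_mul, ← Complex.ofReal_mul, ← Complex.ofReal_one]
          congr 1
          rw [mul_assoc, mul_comm, mul_assoc, ← mul_inv, hsb', mul_inv_cancel₀ (hb' i).ne']
  have hCd : (B * V * B')ᴴ * (Matrix.diagonal fun i => ((a i / b i : ℝ) : ℂ)) * (B * V * B') =
      Matrix.diagonal fun i => ((a' i / b' i : ℝ) : ℂ) := by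
    have e1 : B * (Matrix.diagonal fun i => ((a i / b i : ℝ) : ℂ)) * B =
        Matrix.diagonal fun i => (a i : ℂ) := by
      rw [hB, Matrix.diagonal_mul_diagonal, Matrix.diagonal_mul_diagonal]
      congr 1
      ext i
      rw [← Complex.ofReal_mul, ← Complex.ofReal_mul]
      congr 1
      nth_rewrite 2 [← hsb i]
      have := hsb0 i
      field_simp
    calc _ = B' * (Vᴴ * (B * (Matrix.diagonal fun i => ((a i / b i : ℝ) : ℂ)) * B) * V) * B' := by
          rw [Matrix.conjTranspose_mul, Matrix.conjTranspose_mul, hBH, hB'H]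
          simp only [Matrix.mul_assoc]
      _ = _ := by
          rw [e1, hVa, hB', Matrix.diagonal_mul_diagonal, Matrix.diagonal_mul_diagonal]
          congr 1
          ext i
          rw [← Complex.ofReal_mul, ← Complex.ofReal_mul]
          congr 1
          rw [mul_assoc, mul_comm, mul_assoc, ← mul_inv, hsb', div_eq_mul_inv]
  have h := hf.sum_compression_le hC (fun i => div_nonneg (ha i) (hb i).le)
    (fun i => div_nonneg (ha' i) (hb' i).le) hCd (fun i => ((√(b' i) : ℝ) : ℂ) * x i)
  have hB'x : B' *ᵥ (fun i => ((√(b' i) : ℝ) : ℂ) * x i) = x := by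
    ext i
    rw [hB', Matrix.mulVec_diagonal, ← mul_assoc, ← Complex.ofReal_mul,
      inv_mul_cancel₀ (hsb0' i), Complex.ofReal_one, one_mul]
  rw [← Matrix.mulVec_mulVec, hB'x, ← Matrix.mulVec_mulVec] at h
  simp only [hB, Matrix.mulVec_diagonal, norm_mul, mul_pow, Complex.norm_real, Real.norm_eq_abs,
    sq_abs, Real.sq_sqrt (hb _).le, Real.sq_sqrt (hb' _).le] at h
  calc _ = ∑ i, f (a i / b i) * (b i * ‖(V *ᵥ x) i‖ ^ 2) :=
        Finset.sum_congr rfl fun i _ => by ring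
    _ ≤ _ := h
    _ = _ := Finset.sum_congr rfl fun i _ => by ring

end Hansen

/-! ### The mean generated by `f`, and its bounds. -/

/-- The scalar mean `m_f(x, y) = y f(x / y)` with generating function `f`. -/
noncomputable def generatedMean (f : ℝ → ℝ) (x y : ℝ) : ℝ :=
  if y = 0 then x * f 0 else y * f (x / y)

theorem morozovaChentsov_eq_inv (f : ℝ → ℝ) (x y : ℝ) :
    morozovaChentsov f x y = (generatedMean f x y)⁻¹ := by
  unfold morozovaChentsov generatedMean
  split_ifs <;> rfl

namespace IsStandardOperatorMonotone

variable {f : ℝ → ℝ} (hf : IsStandardOperatorMonotone f)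

include hf

theorem generatedMean_nonneg {x y : ℝ} (hx : 0 ≤ x) (hy : 0 ≤ y) : 0 ≤ generatedMean f x y := by
  unfold generatedMean
  split_ifs
  · exact mul_nonneg hx hf.zero_nonneg
  · exact mul_nonneg hy (hf.nonneg (div_nonneg hx hy))

theorem generatedMean_pos (h0 : 0 < f 0) {x y : ℝ} (hx : 0 ≤ x) (hy : 0 ≤ y)
    (hxy : x ≠ 0 ∨ y ≠ 0) : 0 < generatedMean f x y := by
  unfold generatedMean
  split_ifs with h
  · exact mul_pos (hx.lt_of_ne' (hxy.resolve_right (not_not.2 h))) h0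
  · exact mul_pos (hy.lt_of_ne' h) (h0.trans_le (hf.le_of_le le_rfl (div_nonneg hx hy)))

theorem generatedMean_comm_of_pos {x y : ℝ} (hx : 0 < x) (hy : 0 < y) :
    generatedMean f x y = generatedMean f y x := by
  unfold generatedMean
  rw [if_neg hx.ne', if_neg hy.ne', hf.symmetric (x / y) (by positivity), one_div_div]
  field_simp

theorem generatedMean_le_max {x y : ℝ} (hx : 0 ≤ x) (hy : 0 ≤ y) :
    generatedMean f x y ≤ max x y := by
  have h1 : f 0 ≤ 1 := by simpa using hf.le_max le_rfl
  unfold generatedMean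
  split_ifs with h
  · exact (by nlinarith : x * f 0 ≤ x).trans (le_max_left _ _)
  · have hy' := hy.lt_of_ne' h
    calc y * f (x / y) ≤ y * max 1 (x / y) := by gcongr; exact hf.le_max (div_nonneg hx hy)
      _ = max x y := by
        rw [mul_max_of_nonneg _ _ hy, mul_one, mul_div_cancel₀ _ h, max_comm]

theorem inv_generatedMean_le {x y : ℝ} (hx : 0 < x) (hy : 0 < y) :
    (generatedMean f x y)⁻¹ ≤ (x⁻¹ + y⁻¹) / 2 := by
  have h := hf.harmonic_le (div_pos hx hy)
  have e : 2 * (x / y) / (1 + x / y) * y = ((x⁻¹ + y⁻¹) / 2)⁻¹ := by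
    field_simp
  rw [inv_le_comm₀ _ (by positivity), ← e]
  · unfold generatedMean
    rw [if_neg hy.ne', mul_comm y]
    gcongr
  · unfold generatedMean
    rw [if_neg hy.ne']
    exact mul_pos hy (hf.pos (div_pos hx hy))

/-- Extends inequalities from invertible states to all states. At the origin the ratio is
identically `1`, so the limit is `0`, the default value there. -/
theorem tendsto_generatedMean_add {x y c : ℝ} (hx : 0 ≤ x) (hy : 0 ≤ y) (hc : 0 < c) :
    Filter.Tendsto (fun t : ℝ => generatedMean f (x + c * t) (y + c * t))
      (nhdsWithin 0 (Set.Ioi 0)) (nhds (generatedMean f x y)) := by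
  have hlin : ∀ z : ℝ, Filter.Tendsto (fun t : ℝ => z + c * t) (nhdsWithin 0 (Set.Ioi 0))
      (nhds z) := fun z => by
    have : Continuous fun t : ℝ => z + c * t := by fun_prop
    simpa using (this.tendsto 0).mono_left (nhdsWithin_le_nhds (s := Set.Ioi 0))
  have key : ∀ {x y : ℝ}, 0 ≤ x → 0 < y →
      Filter.Tendsto (fun t : ℝ => (y + c * t) * f ((x + c * t) / (y + c * t)))
        (nhdsWithin 0 (Set.Ioi 0)) (nhds (y * f (x / y))) := by
    intro x y hx hy
    refine Filter.Tendsto.mul (hlin y) ?_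
    refine Filter.Tendsto.comp (hf.continuousOn (x / y) (div_nonneg hx hy.le)) ?_
    refine tendsto_nhdsWithin_iff.2 ⟨(hlin x).div (hlin y) hy.ne', ?_⟩
    filter_upwards [self_mem_nhdsWithin] with t ht
    rw [Set.mem_Ioi] at ht
    change 0 ≤ (x + c * t) / (y + c * t)
    positivity
  rcases hy.eq_or_lt with rfl | hy
  · rcases hx.eq_or_lt with rfl | hx
    · have h0 : generatedMean f 0 0 = 0 := by simp [generatedMean]
      rw [h0]
      refine (hlin 0).congr' ?_
      filter_upwards [self_mem_nhdsWithin] with t ht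
      rw [Set.mem_Ioi] at ht
      have : c * t ≠ 0 := by positivity
      simp [generatedMean, this, hf.normalized]
    · have h0 : generatedMean f x 0 = x * f (0 / x) := by simp [generatedMean]
      rw [h0]
      refine (key le_rfl hx).congr' ?_
      filter_upwards [self_mem_nhdsWithin] with t ht
      rw [Set.mem_Ioi] at ht
      -- At `y = 0 < x` the ratio `x/y` blows up, so the arguments are swapped and continuity of `f`
      -- at `0` is used.
      rw [hf.generatedMean_comm_of_pos (by positivity) (by positivity)]
      unfold generatedMean
      rw [if_neg (by positivity)]
  · have h0 : generatedMean f x y = y * f (x / y) := by simp [generatedMean, hy.ne']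
    rw [h0]
    refine (key hx hy).congr' ?_
    filter_upwards [self_mem_nhdsWithin] with t ht
    rw [Set.mem_Ioi] at ht
    unfold generatedMean
    rw [if_neg (by positivity)]

end IsStandardOperatorMonotone

/-! ### Monotonicity of the metric at diagonal states. -/

section Monotonicity

variable {m n : Type*} [Fintype m] [DecidableEq m] [Fintype n] [DecidableEq n]

theorem trace_mul_conjTranspose_mul_diagonal (A B : Matrix m m ℂ) (d : m → ℂ) :
    (A * Bᴴ * Matrix.diagonal d).trace = ∑ p : m × m, star (B p.1 p.2) * (d p.1 * A p.1 p.2) := by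
  rw [Fintype.sum_prod_type, Matrix.trace]
  refine Finset.sum_congr rfl fun i _ => ?_
  rw [Matrix.diag_apply, Matrix.mul_diagonal, Matrix.mul_apply, Finset.sum_mul]
  refine Finset.sum_congr rfl fun j _ => ?_
  rw [Matrix.conjTranspose_apply]
  ring

theorem trace_conjTranspose_mul_mul_diagonal (A B : Matrix m m ℂ) (d : m → ℂ) :
    (Bᴴ * A * Matrix.diagonal d).trace = ∑ p : m × m, star (B p.1 p.2) * (d p.2 * A p.1 p.2) := by
  rw [Fintype.sum_prod_type_right, Matrix.trace]
  refine Finset.sum_congr rfl fun i _ => ?_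
  rw [Matrix.diag_apply, Matrix.mul_diagonal, Matrix.mul_apply, Finset.sum_mul]
  refine Finset.sum_congr rfl fun j _ => ?_
  rw [Matrix.conjTranspose_apply]
  ring

theorem trace_conjTranspose_mul (A B : Matrix m m ℂ) :
    (Aᴴ * B).trace = ∑ i, ∑ j, star (A i j) * B i j := by
  have := trace_conjTranspose_mul_mul_diagonal B A (fun _ => 1)
  rw [Matrix.diagonal_one, Matrix.mul_one, Fintype.sum_prod_type] at this
  simpa only [one_mul] using this

/-- The matrix of a linear map between spaces of matrices. -/
noncomputable def linearMapMatrix (Φ : Matrix n n ℂ →⋆ₐ[ℂ] Matrix m m ℂ) :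
    Matrix (m × m) (n × n) ℂ :=
  Matrix.of fun p q => Φ (Matrix.single q.1 q.2 1) p.1 p.2

theorem linearMapMatrix_mulVec (Φ : Matrix n n ℂ →⋆ₐ[ℂ] Matrix m m ℂ) (X : Matrix n n ℂ)
    (p : m × m) : (linearMapMatrix Φ *ᵥ fun q => X q.1 q.2) p = Φ X p.1 p.2 := by
  conv_rhs => rw [Matrix.matrix_eq_sum_single X]
  simp only [map_sum, Matrix.sum_apply, Matrix.mulVec, dotProduct, linearMapMatrix,
    Matrix.of_apply, Fintype.sum_prod_type]
  refine Finset.sum_congr rfl fun i _ => Finset.sum_congr rfl fun j _ => ?_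
  have : Matrix.single i j (X i j) = X i j • Matrix.single i j (1 : ℂ) := by
    rw [Matrix.smul_single, smul_eq_mul, mul_one]
  rw [this, map_smul, Matrix.smul_apply, smul_eq_mul, mul_comm]

/-- Left multiplication by the state pulls back to left multiplication: `Tr(Φ(X) Φ(Y)ᴴ ρ) = Tr(Φ(X
Yᴴ) ρ) = Tr(X Yᴴ σ)`. Multiplicativity of `Φ` is essential. The right-handed version uses `Yᴴ X`
instead. -/
theorem linearMapMatrix_left (Φ : Matrix n n ℂ →⋆ₐ[ℂ] Matrix m m ℂ) {r : m → ℝ} {s : n → ℝ}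
    (h : ∀ X, (Φ X * Matrix.diagonal fun i => (r i : ℂ)).trace =
      (X * Matrix.diagonal fun i => (s i : ℂ)).trace) :
    (linearMapMatrix Φ)ᴴ * (Matrix.diagonal fun p : m × m => (r p.1 : ℂ)) * linearMapMatrix Φ =
      Matrix.diagonal fun q : n × n => (s q.1 : ℂ) := by
  ext ⟨a, b⟩ ⟨c, d⟩
  have h1 := h (Matrix.single c d 1 * (Matrix.single a b 1)ᴴ)
  rw [map_mul, ← Matrix.star_eq_conjTranspose, map_star, Matrix.star_eq_conjTranspose,
    trace_mul_conjTranspose_mul_diagonal, Matrix.star_eq_conjTranspose,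
    trace_mul_conjTranspose_mul_diagonal] at h1
  rw [Matrix.mul_assoc, Matrix.mul_apply]
  simp only [Matrix.diagonal_mul, Matrix.conjTranspose_apply, linearMapMatrix, Matrix.of_apply]
  rw [h1, Fintype.sum_eq_single (c, d)]
  · by_cases hac : a = c <;> by_cases hbd : b = d <;>
      simp [Matrix.diagonal_apply, Matrix.single_apply, hac, hbd]
  · rintro ⟨i, j⟩ hij
    have : ¬ (c = i ∧ d = j) := fun h => hij (by rw [h.1, h.2])
    simp [Matrix.single_apply, this]

theorem linearMapMatrix_right (Φ : Matrix n n ℂ →⋆ₐ[ℂ] Matrix m m ℂ) {r : m → ℝ} {s : n → ℝ}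
    (h : ∀ X, (Φ X * Matrix.diagonal fun i => (r i : ℂ)).trace =
      (X * Matrix.diagonal fun i => (s i : ℂ)).trace) :
    (linearMapMatrix Φ)ᴴ * (Matrix.diagonal fun p : m × m => (r p.2 : ℂ)) * linearMapMatrix Φ =
      Matrix.diagonal fun q : n × n => (s q.2 : ℂ) := by
  ext ⟨a, b⟩ ⟨c, d⟩
  have h1 := h ((Matrix.single a b 1)ᴴ * Matrix.single c d 1)
  rw [map_mul, ← Matrix.star_eq_conjTranspose, map_star, Matrix.star_eq_conjTranspose,
    trace_conjTranspose_mul_mul_diagonal, Matrix.star_eq_conjTranspose,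
    trace_conjTranspose_mul_mul_diagonal] at h1
  rw [Matrix.mul_assoc, Matrix.mul_apply]
  simp only [Matrix.diagonal_mul, Matrix.conjTranspose_apply, linearMapMatrix, Matrix.of_apply]
  rw [h1, Fintype.sum_eq_single (c, d)]
  · by_cases hac : a = c <;> by_cases hbd : b = d <;>
      simp [Matrix.diagonal_apply, Matrix.single_apply, hac, hbd]
  · rintro ⟨i, j⟩ hij
    have : ¬ (c = i ∧ d = j) := fun h => hij (by rw [h.1, h.2])
    simp [Matrix.single_apply, this]

variable {f : ℝ → ℝ}

theorem IsStandardOperatorMonotone.sum_generatedMean_le_of_pos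
    (hf : IsStandardOperatorMonotone f)
    (Φ : Matrix n n ℂ →⋆ₐ[ℂ] Matrix m m ℂ) {r : m → ℝ} {s : n → ℝ} (hr : ∀ i, 0 < r i)
    (hs : ∀ i, 0 < s i)
    (h : ∀ X, (Φ X * Matrix.diagonal fun i => (r i : ℂ)).trace =
      (X * Matrix.diagonal fun i => (s i : ℂ)).trace) (X : Matrix n n ℂ) :
    ∑ i, ∑ j, generatedMean f (r i) (r j) * ‖Φ X i j‖ ^ 2 ≤
      ∑ i, ∑ j, generatedMean f (s i) (s j) * ‖X i j‖ ^ 2 := by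
  have key := hf.sum_transformer_le (fun p : m × m => (hr p.1).le) (fun p => hr p.2)
    (fun q : n × n => (hs q.1).le) (fun q => hs q.2) (linearMapMatrix_left Φ h)
    (linearMapMatrix_right Φ h) (fun q => X q.1 q.2)
  simp only [linearMapMatrix_mulVec] at key
  simp only [generatedMean, (hr _).ne', (hs _).ne', if_false]
  rwa [Fintype.sum_prod_type, Fintype.sum_prod_type] at key

/-- The trace-dual of `Φ` sends `1` to `d • 1`, so adding `t` to `r` and `d t` to `s` preserves
duality and makes both positive; then `t → 0`. -/
theorem IsStandardOperatorMonotone.sum_generatedMean_le (hf : IsStandardOperatorMonotone f)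
    (Φ : Matrix n n ℂ →⋆ₐ[ℂ] Matrix m m ℂ) {r : m → ℝ} {s : n → ℝ} (hr : ∀ i, 0 ≤ r i)
    (hs : ∀ i, 0 ≤ s i)
    (h : ∀ X, (Φ X * Matrix.diagonal fun i => (r i : ℂ)).trace =
      (X * Matrix.diagonal fun i => (s i : ℂ)).trace)
    {d : ℝ} (hd : 0 < d) (hΦ : ∀ X, (Φ X).trace = d * X.trace) (X : Matrix n n ℂ) :
    ∑ i, ∑ j, generatedMean f (r i) (r j) * ‖Φ X i j‖ ^ 2 ≤
      ∑ i, ∑ j, generatedMean f (s i) (s j) * ‖X i j‖ ^ 2 := by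
  refine le_of_tendsto_of_tendsto
    (tendsto_finsetSum _ fun i _ => tendsto_finsetSum _ fun j _ =>
      (hf.tendsto_generatedMean_add (hr i) (hr j) one_pos).mul_const _)
    (tendsto_finsetSum _ fun i _ => tendsto_finsetSum _ fun j _ =>
      (hf.tendsto_generatedMean_add (hs i) (hs j) hd).mul_const _) ?_
  filter_upwards [self_mem_nhdsWithin] with t ht
  rw [Set.mem_Ioi] at ht
  refine hf.sum_generatedMean_le_of_pos Φ
    (fun i => add_pos_of_nonneg_of_pos (hr i) (mul_pos one_pos ht))
    (fun i => add_pos_of_nonneg_of_pos (hs i) (mul_pos hd ht)) (fun Y => ?_) X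
  have e1 : (Matrix.diagonal fun i => ((r i + 1 * t : ℝ) : ℂ)) =
      (Matrix.diagonal fun i => (r i : ℂ)) + (t : ℂ) • (1 : Matrix m m ℂ) := by
    rw [Matrix.smul_one_eq_diagonal, Matrix.diagonal_add]
    simp
  have e2 : (Matrix.diagonal fun i => ((s i + d * t : ℝ) : ℂ)) =
      (Matrix.diagonal fun i => (s i : ℂ)) + (d * t : ℂ) • (1 : Matrix n n ℂ) := by
    rw [Matrix.smul_one_eq_diagonal, Matrix.diagonal_add]
    simp
  rw [e1, e2, Matrix.mul_add, Matrix.mul_add, Matrix.trace_add, Matrix.trace_add, h,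
    Matrix.mul_smul, Matrix.mul_smul, Matrix.mul_one, Matrix.mul_one, Matrix.trace_smul,
    Matrix.trace_smul, hΦ, smul_eq_mul, smul_eq_mul]
  ring

/-- Monotonicity of the metric with Morozova-Chentsov function `c_f` at diagonal states. -/
theorem IsStandardOperatorMonotone.sum_morozovaChentsov_le (hf : IsStandardOperatorMonotone f)
    (h0 : 0 < f 0) (Φ : Matrix n n ℂ →⋆ₐ[ℂ] Matrix m m ℂ) {r : m → ℝ} {s : n → ℝ}
    (hr : ∀ i, 0 ≤ r i) (hs : ∀ i, 0 ≤ s i)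
    (h : ∀ X, (Φ X * Matrix.diagonal fun i => (r i : ℂ)).trace =
      (X * Matrix.diagonal fun i => (s i : ℂ)).trace)
    {d : ℝ} (hd : 0 < d) (hΦ : ∀ X, (Φ X).trace = d * X.trace)
    {K : Matrix m m ℂ} {L : Matrix n n ℂ} (hKL : ∀ X, (Φ X * K).trace = (X * L).trace)
    (hK : ∀ i j, r i = 0 → r j = 0 → K i j = 0) :
    ∑ i, ∑ j, morozovaChentsov f (s i) (s j) * ‖L i j‖ ^ 2 ≤
      ∑ i, ∑ j, morozovaChentsov f (r i) (r j) * ‖K i j‖ ^ 2 := by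
  -- This `X` attains equality in the duality between the weights `m_f` and `c_f`. Thus `∑ c_f |L|²
  -- = Tr(Xᴴ L) = Tr(Φ(X)ᴴ K)`, at most half of `∑ m_f |Φ X|² + ∑ c_f |K|²`, and the first sum is at
  -- most `∑ m_f |X|² = ∑ c_f |L|²`.
  set X : Matrix n n ℂ := Matrix.of fun i j => (morozovaChentsov f (s i) (s j) : ℂ) * L i j with hX
  have h1 := hKL Xᴴ
  rw [← Matrix.star_eq_conjTranspose, map_star, Matrix.star_eq_conjTranspose,
    Matrix.star_eq_conjTranspose, trace_conjTranspose_mul, trace_conjTranspose_mul] at h1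
  have h2 : ∑ i, ∑ j, star (X i j) * L i j =
      ((∑ i, ∑ j, morozovaChentsov f (s i) (s j) * ‖L i j‖ ^ 2 : ℝ) : ℂ) := by
    simp only [Complex.ofReal_sum]
    refine Finset.sum_congr rfl fun i _ => Finset.sum_congr rfl fun j _ => ?_
    rw [hX, Matrix.of_apply, star_mul', Complex.ofReal_mul, Complex.ofReal_pow,
      ← Complex.conj_mul', RCLike.star_def, Complex.conj_ofReal, mul_assoc]
  have h3 := congrArg Complex.re (h1.trans h2)
  rw [Complex.ofReal_re, Complex.re_sum] at h3
  simp only [Complex.re_sum] at h3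
  have h4 : ∀ i j, (star (Φ X i j) * K i j).re ≤
      (generatedMean f (r i) (r j) * ‖Φ X i j‖ ^ 2 +
        morozovaChentsov f (r i) (r j) * ‖K i j‖ ^ 2) / 2 := by
    intro i j
    -- Where both eigenvalues vanish the mean is `0` and has no true inverse; there `hK` makes the
    -- term vanish.
    by_cases hij : r i = 0 ∧ r j = 0
    · rw [hK i j hij.1 hij.2]
      have := hf.generatedMean_nonneg (hr i) (hr j)
      simp only [mul_zero, Complex.zero_re, norm_zero, zero_pow two_ne_zero, add_zero]
      positivity
    · have hm := hf.generatedMean_pos h0 (hr i) (hr j) (not_and_or.1 hij)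
      rw [morozovaChentsov_eq_inv]
      set M := generatedMean f (r i) (r j)
      have hre : (star (Φ X i j) * K i j).re ≤ ‖Φ X i j‖ * ‖K i j‖ := by
        refine (Complex.re_le_norm _).trans ?_
        rw [norm_mul, norm_star]
      refine hre.trans ?_
      have e : M * ‖Φ X i j‖ ^ 2 + M⁻¹ * ‖K i j‖ ^ 2 - 2 * (‖Φ X i j‖ * ‖K i j‖) =
          M⁻¹ * (M * ‖Φ X i j‖ - ‖K i j‖) ^ 2 := by
        field_simp
        ring
      have : 0 ≤ M⁻¹ * (M * ‖Φ X i j‖ - ‖K i j‖) ^ 2 := by positivity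
      linarith
  have h5 := hf.sum_generatedMean_le Φ hr hs h hd hΦ X
  have h6 : ∀ i j, generatedMean f (s i) (s j) * ‖X i j‖ ^ 2 =
      morozovaChentsov f (s i) (s j) * ‖L i j‖ ^ 2 := by
    intro i j
    rw [hX, Matrix.of_apply, norm_mul, Complex.norm_real, mul_pow, Real.norm_eq_abs, sq_abs,
      morozovaChentsov_eq_inv]
    by_cases hM : generatedMean f (s i) (s j) = 0
    · simp [hM]
    · field_simp
  simp only [h6] at h5
  have h7 := Finset.sum_le_sum fun i (_ : i ∈ Finset.univ) =>
    Finset.sum_le_sum fun j (_ : j ∈ Finset.univ) => h4 i j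
  simp only [← Finset.sum_div, Finset.sum_add_distrib] at h7
  linarith

end Monotonicity

/-! ### States and velocities in the eigenbasis. -/

namespace DensityMatrix

variable {m n : Type*} [Fintype m] [DecidableEq m] [Fintype n] [DecidableEq n]

/-- The eigenvalues of a state. -/
noncomputable def eigenvalue (ρ : DensityMatrix n) : n → ℝ := ρ.posSemidef.isHermitian.eigenvalues

/-- The matrix of an operator in the eigenbasis of a state. -/
noncomputable def inEigenbasis (ρ : DensityMatrix n) : Matrix n n ℂ ≃⋆ₐ[ℂ] Matrix n n ℂ :=
  Unitary.conjStarAlgAut ℂ _ (star ρ.posSemidef.isHermitian.eigenvectorUnitary)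

theorem inEigenbasis_apply (ρ : DensityMatrix n) (X : Matrix n n ℂ) :
    ρ.inEigenbasis X = star (ρ.posSemidef.isHermitian.eigenvectorUnitary : Matrix n n ℂ) * X *
      ρ.posSemidef.isHermitian.eigenvectorUnitary := by
  simp [inEigenbasis, Unitary.conjStarAlgAut_apply]

theorem inEigenbasis_mat (ρ : DensityMatrix n) :
    ρ.inEigenbasis ρ.mat = Matrix.diagonal fun i => (ρ.eigenvalue i : ℂ) :=
  ρ.posSemidef.isHermitian.conjStarAlgAut_star_eigenvectorUnitary

theorem trace_inEigenbasis (ρ : DensityMatrix n) (X : Matrix n n ℂ) :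
    (ρ.inEigenbasis X).trace = X.trace := by
  rw [inEigenbasis_apply, Matrix.trace_mul_cycle, Unitary.mul_star_self_of_mem
    (ρ.posSemidef.isHermitian.eigenvectorUnitary.2), Matrix.one_mul]

theorem trace_inEigenbasis_symm (ρ : DensityMatrix n) (X : Matrix n n ℂ) :
    (ρ.inEigenbasis.symm X).trace = X.trace := by
  rw [← ρ.trace_inEigenbasis, StarAlgEquiv.apply_symm_apply]

theorem eigenvalue_nonneg (ρ : DensityMatrix n) (i : n) : 0 ≤ ρ.eigenvalue i :=
  ρ.posSemidef.eigenvalues_nonneg i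

theorem inEigenbasis_isHermitian (ρ : DensityMatrix n) {X : Matrix n n ℂ} (hX : X.IsHermitian) :
    (ρ.inEigenbasis X).IsHermitian := by
  have := map_star ρ.inEigenbasis X
  rw [Matrix.star_eq_conjTranspose, Matrix.star_eq_conjTranspose, hX.eq] at this
  exact this.symm

/-- The velocity `i [H, ρ]` of the state `ρ` evolving under the Hamiltonian `H`. -/
noncomputable def velocity (ρ : DensityMatrix n) (H : Matrix n n ℂ) : Matrix n n ℂ :=
  Complex.I • (H * ρ.mat - ρ.mat * H)

omit [DecidableEq n] in
theorem velocity_isHermitian (ρ : DensityMatrix n) {H : Matrix n n ℂ} (hH : H.IsHermitian) :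
    (ρ.velocity H).IsHermitian := by
  unfold velocity Matrix.IsHermitian
  rw [Matrix.conjTranspose_smul, Matrix.conjTranspose_sub, Matrix.conjTranspose_mul,
    Matrix.conjTranspose_mul, hH.eq, ρ.posSemidef.isHermitian.eq, RCLike.star_def, Complex.conj_I,
    neg_smul, ← smul_neg, neg_sub]

theorem inEigenbasis_velocity_apply (ρ : DensityMatrix n) (H : Matrix n n ℂ) (i j : n) :
    ρ.inEigenbasis (ρ.velocity H) i j =
      Complex.I * ((ρ.eigenvalue j - ρ.eigenvalue i) * ρ.inEigenbasis H i j) := by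
  unfold velocity
  rw [map_smul, map_sub, map_mul, map_mul, inEigenbasis_mat, Matrix.smul_apply, Matrix.sub_apply,
    Matrix.mul_diagonal, Matrix.diagonal_mul, smul_eq_mul]
  ring

theorem inEigenbasis_velocity_eq_zero (ρ : DensityMatrix n) (H : Matrix n n ℂ) (i j : n)
    (hi : ρ.eigenvalue i = 0) (hj : ρ.eigenvalue j = 0) :
    ρ.inEigenbasis (ρ.velocity H) i j = 0 := by
  rw [inEigenbasis_velocity_apply, hi, hj]
  simp

end DensityMatrix

/-! ### Monotonicity of the skew information. -/

section Monotonicity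

variable {m n : Type*} [Fintype m] [DecidableEq m] [Fintype n] [DecidableEq n] {f : ℝ → ℝ}

/-- The skew information in the eigenbasis of the state. -/
theorem skewInformation_eq_sum (f : ℝ → ℝ) (ρ : DensityMatrix n) {H : Matrix n n ℂ}
    (hH : H.IsHermitian) :
    skewInformation f ρ H = f 0 / 2 * ∑ i, ∑ j,
      morozovaChentsov f (ρ.eigenvalue i) (ρ.eigenvalue j) *
        ‖ρ.inEigenbasis (ρ.velocity H) i j‖ ^ 2 := by
  have hK := ρ.inEigenbasis_isHermitian (ρ.velocity_isHermitian hH)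
  have e : skewInformation f ρ H = f 0 / 2 *
      (ρ.velocity H * leftRightCalculus (morozovaChentsov f) ρ (ρ.velocity H)).trace.re := rfl
  rw [e]
  congr 1
  set K := ρ.velocity H
  have h1 : (K * leftRightCalculus (morozovaChentsov f) ρ K).trace =
      ((ρ.inEigenbasis K)ᴴ * Matrix.of fun i j =>
        (morozovaChentsov f (ρ.eigenvalue i) (ρ.eigenvalue j) : ℂ) *
          ρ.inEigenbasis K i j).trace := by
    rw [hK.eq]
    unfold leftRightCalculus
    rw [← Matrix.mul_assoc, ← Matrix.mul_assoc, Matrix.trace_mul_cycle, ρ.inEigenbasis_apply K]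
    simp only [Matrix.mul_assoc]
    rfl
  rw [h1, trace_conjTranspose_mul, Complex.re_sum]
  refine Finset.sum_congr rfl fun i _ => ?_
  rw [Complex.re_sum]
  refine Finset.sum_congr rfl fun j _ => ?_
  rw [Matrix.of_apply, mul_left_comm, RCLike.star_def, Complex.conj_mul', ← Complex.ofReal_pow,
    ← Complex.ofReal_mul, Complex.ofReal_re]

/-- Monotonicity of the skew information: if the trace-dual of the unital `*`-homomorphism `Φ`
sends `ρ` to `σ` and `i [H, ρ]` to `i [L, σ]`, then `I^f(σ, L) ≤ I^f(ρ, H)`. -/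
theorem IsStandardOperatorMonotone.skewInformation_le (hf : IsStandardOperatorMonotone f)
    (Φ : Matrix n n ℂ →⋆ₐ[ℂ] Matrix m m ℂ) {ρ : DensityMatrix m} {σ : DensityMatrix n}
    (h : ∀ X, (Φ X * ρ.mat).trace = (X * σ.mat).trace)
    {d : ℝ} (hd : 0 < d) (hΦ : ∀ X, (Φ X).trace = d * X.trace)
    {H : Matrix m m ℂ} {L : Matrix n n ℂ} (hH : H.IsHermitian) (hL : L.IsHermitian)
    (hHL : ∀ X, (Φ X * ρ.velocity H).trace = (X * σ.velocity L).trace) :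
    skewInformation f σ L ≤ skewInformation f ρ H := by
  rw [skewInformation_eq_sum f ρ hH, skewInformation_eq_sum f σ hL]
  rcases hf.zero_nonneg.eq_or_lt with h0 | h0
  · simp [← h0]
  refine mul_le_mul_of_nonneg_left ?_ (by positivity)
  let Ψ : Matrix n n ℂ →⋆ₐ[ℂ] Matrix m m ℂ :=
    (ρ.inEigenbasis : Matrix m m ℂ →⋆ₐ[ℂ] Matrix m m ℂ).comp
      (Φ.comp (σ.inEigenbasis.symm : Matrix n n ℂ →⋆ₐ[ℂ] Matrix n n ℂ))
  have hΨ : ∀ X, Ψ X = ρ.inEigenbasis (Φ (σ.inEigenbasis.symm X)) := fun X => rfl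
  have hdual : ∀ (A : Matrix m m ℂ) (B : Matrix n n ℂ),
      (∀ X, (Φ X * A).trace = (X * B).trace) →
      ∀ X, (Ψ X * ρ.inEigenbasis A).trace = (X * σ.inEigenbasis B).trace := by
    intro A B hAB X
    rw [hΨ, ← map_mul, ρ.trace_inEigenbasis, hAB, ← σ.trace_inEigenbasis, map_mul,
      StarAlgEquiv.apply_symm_apply]
  refine hf.sum_morozovaChentsov_le h0 Ψ ρ.eigenvalue_nonneg σ.eigenvalue_nonneg ?_ hd ?_
    (hdual _ _ hHL) (ρ.inEigenbasis_velocity_eq_zero H)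
  · rw [← ρ.inEigenbasis_mat, ← σ.inEigenbasis_mat]
    exact hdual _ _ h
  · intro X
    rw [hΨ, ρ.trace_inEigenbasis, hΦ, σ.trace_inEigenbasis_symm]

end Monotonicity

/-! ### Local operators, partial traces and weak superadditivity. -/

section LocalOperators

variable {k : ℕ} {ι : Fin k → Type*} [∀ j, Fintype (ι j)] [∀ j, DecidableEq (ι j)]

/-- The local operator `A ⊗ 𝕀` acting as `A` on the `j`th subsystem. -/
def localOperator (j : Fin k) :
    Matrix (ι j) (ι j) ℂ →⋆ₐ[ℂ] Matrix (∀ j, ι j) (∀ j, ι j) ℂ where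
  toFun A := (A ⊗ₖ (1 : Matrix (∀ i : {i // i ≠ j}, ι i) (∀ i : {i // i ≠ j}, ι i) ℂ)).submatrix
    (Equiv.piSplitAt j ι) (Equiv.piSplitAt j ι)
  map_one' := by rw [Matrix.one_kronecker_one, Matrix.submatrix_one_equiv]
  map_mul' A B := by
    rw [Matrix.submatrix_mul_equiv, ← Matrix.mul_kronecker_mul, Matrix.one_mul]
  map_zero' := by rw [Matrix.zero_kronecker, Matrix.submatrix_zero]; rfl
  map_add' A B := by rw [Matrix.add_kronecker, Matrix.submatrix_add]; rfl
  commutes' r := by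
    rw [Algebra.algebraMap_eq_smul_one, Algebra.algebraMap_eq_smul_one, Matrix.smul_kronecker,
      Matrix.one_kronecker_one, Matrix.submatrix_smul, Pi.smul_apply, Pi.smul_apply,
      Matrix.submatrix_one_equiv]
  map_star' A := by
    rw [Matrix.star_eq_conjTranspose, Matrix.star_eq_conjTranspose,
      Matrix.conjTranspose_submatrix, Matrix.conjTranspose_kronecker, Matrix.conjTranspose_one]

theorem localOperator_apply (j : Fin k) (A : Matrix (ι j) (ι j) ℂ) (x y : ∀ j, ι j) :
    localOperator j A x y = A (x j) (y j) *
      (1 : Matrix (∀ i : {i // i ≠ j}, ι i) (∀ i : {i // i ≠ j}, ι i) ℂ)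
        (fun i => x i) (fun i => y i) := rfl

theorem additiveHamiltonian_eq_sum (H : ∀ j, Matrix (ι j) (ι j) ℂ) :
    additiveHamiltonian H = ∑ j, localOperator j (H j) := rfl

theorem piSplitAt_symm_eq_update {ι : Fin k → Type*} (j : Fin k) (x : ∀ j, ι j) (a : ι j) :
    (Equiv.piSplitAt j ι).symm (a, fun i => x i) = Function.update x j a := by
  ext i
  by_cases h : i = j
  · subst h
    simp
  · simp [Equiv.piSplitAt_symm_apply, h]

theorem localOperator_mul_apply (j : Fin k) (A : Matrix (ι j) (ι j) ℂ)
    (M : Matrix (∀ j, ι j) (∀ j, ι j) ℂ) (x y : ∀ j, ι j) :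
    (localOperator j A * M) x y = ∑ a, A (x j) a * M (Function.update x j a) y := by
  rw [Matrix.mul_apply, ← Equiv.sum_comp (Equiv.piSplitAt j ι).symm, Fintype.sum_prod_type]
  refine Finset.sum_congr rfl fun a _ => ?_
  rw [Fintype.sum_eq_single (fun i : {i // i ≠ j} => x i.1), piSplitAt_symm_eq_update,
    localOperator_apply]
  · have : (fun i : {i // i ≠ j} => Function.update x j a i) =
        fun i : {i // i ≠ j} => x i := by
      ext i
      exact Function.update_of_ne i.2 _ _
    rw [this, Matrix.one_apply_eq, mul_one, Function.update_self]
  · intro w hw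
    have : (fun i : {i // i ≠ j} => (Equiv.piSplitAt j ι).symm (a, w) i) = w := by
      ext i
      simp [Equiv.piSplitAt_symm_apply, i.2]
    rw [localOperator_apply, this, Matrix.one_apply_ne hw.symm, mul_zero, zero_mul]

theorem localOperator_commute {j l : Fin k} (hjl : j ≠ l) (A : Matrix (ι j) (ι j) ℂ)
    (B : Matrix (ι l) (ι l) ℂ) :
    localOperator j A * localOperator l B = localOperator l B * localOperator j A := by
  have key : ∀ {j l : Fin k} (_ : j ≠ l) (A : Matrix (ι j) (ι j) ℂ) (B : Matrix (ι l) (ι l) ℂ)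
      (x y : ∀ j, ι j), (localOperator j A * localOperator l B) x y =
        ∑ a, ∑ b, A (x j) a * B (x l) b *
          (1 : Matrix _ _ ℂ) (Function.update (Function.update x j a) l b) y := by
    intro j l hjl A B x y
    rw [localOperator_mul_apply]
    refine Finset.sum_congr rfl fun a _ => ?_
    rw [← Matrix.mul_one (localOperator l B), localOperator_mul_apply, Finset.mul_sum]
    refine Finset.sum_congr rfl fun b _ => ?_
    rw [Function.update_of_ne hjl.symm, mul_assoc]
  ext x y
  rw [key hjl, key hjl.symm, Finset.sum_comm]
  refine Finset.sum_congr rfl fun b _ => Finset.sum_congr rfl fun a _ => ?_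
  rw [Function.update_comm hjl, mul_comm (A _ _)]

theorem trace_localOperator (j : Fin k) (A : Matrix (ι j) (ι j) ℂ) :
    (localOperator j A).trace =
      ((Fintype.card (∀ i : {i // i ≠ j}, ι i) : ℝ) : ℂ) * A.trace := by
  have : (localOperator j A).trace = (A ⊗ₖ (1 : Matrix (∀ i : {i // i ≠ j}, ι i)
      (∀ i : {i // i ≠ j}, ι i) ℂ)).trace :=
    Equiv.sum_comp (Equiv.piSplitAt j ι) fun p => (A ⊗ₖ (1 : Matrix (∀ i : {i // i ≠ j}, ι i)
      (∀ i : {i // i ≠ j}, ι i) ℂ)) p p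
  rw [this, Matrix.trace_kronecker, Matrix.trace_one, mul_comm]
  simp

theorem trace_localOperator_mul_mat (ρ : DensityMatrix (∀ j, ι j)) (j : Fin k)
    (A : Matrix (ι j) (ι j) ℂ) :
    (localOperator j A * ρ.mat).trace = (A * (reducedState ρ j).mat).trace := by
  rw [Matrix.trace, Matrix.trace, ← Equiv.sum_comp (Equiv.piSplitAt j ι).symm,
    Fintype.sum_prod_type]
  refine Finset.sum_congr rfl fun a _ => ?_
  simp only [Matrix.diag_apply, localOperator_mul_apply]
  simp only [Matrix.mul_apply, reducedState, Matrix.of_apply, Finset.mul_sum]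
  rw [Finset.sum_comm]
  refine Finset.sum_congr rfl fun b _ => Finset.sum_congr rfl fun w _ => ?_
  have h1 : (Equiv.piSplitAt j ι).symm (a, w) j = a := by simp
  have h2 : Function.update ((Equiv.piSplitAt j ι).symm (a, w)) j b =
      (Equiv.piSplitAt j ι).symm (b, w) := by
    rw [← piSplitAt_symm_eq_update]
    congr 2
    ext i
    simp [Equiv.piSplitAt_symm_apply, i.2]
  rw [h1, h2]

theorem additiveHamiltonian_isHermitian {H : ∀ j, Matrix (ι j) (ι j) ℂ}
    (hH : ∀ j, (H j).IsHermitian) : (additiveHamiltonian H).IsHermitian := by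
  rw [additiveHamiltonian_eq_sum]
  change IsSelfAdjoint _
  exact isSelfAdjoint_sum _ fun j _ => (show IsSelfAdjoint (H j) from hH j).map (localOperator j)

/-- Only the `j`th term fails to commute with an operator on the `j`th factor. Dually, the partial
trace of `i[H_{1…k}, ρ]` is `i[H_j, ρ_j]`. -/
theorem localOperator_mul_additiveHamiltonian_sub (H : ∀ j, Matrix (ι j) (ι j) ℂ) (j : Fin k)
    (A : Matrix (ι j) (ι j) ℂ) :
    localOperator j A * additiveHamiltonian H - additiveHamiltonian H * localOperator j A =
      localOperator j (A * H j - H j * A) := by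
  rw [additiveHamiltonian_eq_sum, Finset.mul_sum, Finset.sum_mul, ← Finset.sum_sub_distrib,
    Finset.sum_eq_single j, map_sub, map_mul, map_mul]
  · intro l _ hl
    rw [localOperator_commute hl.symm, sub_self]
  · exact fun h => absurd (Finset.mem_univ j) h

theorem trace_mul_velocity {n : Type*} [Fintype n] (ρ : DensityMatrix n) (X H : Matrix n n ℂ) :
    (X * ρ.velocity H).trace = Complex.I * ((X * H - H * X) * ρ.mat).trace := by
  unfold DensityMatrix.velocity
  rw [Matrix.mul_smul, Matrix.trace_smul, smul_eq_mul, Matrix.mul_sub, Matrix.sub_mul,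
    Matrix.trace_sub, Matrix.trace_sub, Matrix.mul_assoc, ← Matrix.mul_assoc X ρ.mat H,
    Matrix.trace_mul_cycle X ρ.mat H]

/-- The skew information of a subsystem is at most that of the whole system. -/
theorem IsStandardOperatorMonotone.skewInformation_reducedState_le {f : ℝ → ℝ}
    (hf : IsStandardOperatorMonotone f) (ρ : DensityMatrix (∀ j, ι j))
    {H : ∀ j, Matrix (ι j) (ι j) ℂ} (hH : ∀ j, (H j).IsHermitian) (j : Fin k) :
    skewInformation f (reducedState ρ j) (H j) ≤ skewInformation f ρ (additiveHamiltonian H) := by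
  -- A state of trace one excludes an empty basis, so the complementary dimension `d` in the trace
  -- rule is positive.
  have hne : Nonempty (∀ j, ι j) := by
    by_contra h
    rw [not_nonempty_iff] at h
    have := ρ.trace_eq_one
    simp [Matrix.trace] at this
  have hcard : 0 < (Fintype.card (∀ i : {i // i ≠ j}, ι i) : ℝ) := by
    obtain ⟨x⟩ := hne
    exact_mod_cast Fintype.card_pos_iff.2 ⟨fun i : {i // i ≠ j} => x i⟩
  refine hf.skewInformation_le (localOperator j) (trace_localOperator_mul_mat ρ j) hcard
    (trace_localOperator j) (additiveHamiltonian_isHermitian hH) (hH j) fun X => ?_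
  rw [trace_mul_velocity, trace_mul_velocity, localOperator_mul_additiveHamiltonian_sub,
    trace_localOperator_mul_mat]

theorem IsStandardOperatorMonotone.weak_superadditivity {f : ℝ → ℝ}
    (hf : IsStandardOperatorMonotone f) (hk : 1 ≤ k) (ρ : DensityMatrix (∀ j, ι j))
    {H : ∀ j, Matrix (ι j) (ι j) ℂ} (hH : ∀ j, (H j).IsHermitian) :
    (1 / (k : ℝ)) * ∑ j, skewInformation f (reducedState ρ j) (H j)
      ≤ skewInformation f ρ (additiveHamiltonian H) := by
  have hk' : 0 < (k : ℝ) := by exact_mod_cast hk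
  have h := Finset.sum_le_sum fun j (_ : j ∈ Finset.univ) =>
    hf.skewInformation_reducedState_le ρ hH j
  rw [Finset.sum_const, Finset.card_univ, Fintype.card_fin, nsmul_eq_mul] at h
  rw [one_div, inv_mul_le_iff₀ hk']
  exact h

end LocalOperators

/-! ### Two-sided bounds for the skew information. -/

section Bounds

variable {n : Type*} [Fintype n] [DecidableEq n] {f : ℝ → ℝ}

theorem Matrix.PosSemidef.apply_eq_zero_of_diag_eq_zero {P : Matrix n n ℂ} (hP : P.PosSemidef)
    {i : n} (hi : P i i = 0) (j : n) : P i j = 0 := by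
  have h := (hP.dotProduct_mulVec_zero_iff (Pi.single i 1)).1 (by
    simpa [Pi.star_single] using hi)
  have hj : P j i = 0 := by simpa using congrFun h j
  rw [← hP.1.apply, hj, star_zero]

theorem trace_conjTranspose_mul_self_eq_sum (A : Matrix n n ℂ) :
    (Aᴴ * A).trace = ((∑ i, ∑ j, ‖A i j‖ ^ 2 : ℝ) : ℂ) := by
  rw [trace_conjTranspose_mul, Complex.ofReal_sum]
  refine Finset.sum_congr rfl fun i _ => ?_
  rw [Complex.ofReal_sum]
  refine Finset.sum_congr rfl fun j _ => ?_
  rw [RCLike.star_def, Complex.conj_mul', Complex.ofReal_pow]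

theorem DensityMatrix.map_conjTranspose_inEigenbasis (ρ : DensityMatrix n) (X : Matrix n n ℂ) :
    ρ.inEigenbasis Xᴴ = (ρ.inEigenbasis X)ᴴ := map_star ρ.inEigenbasis X

theorem DensityMatrix.posSemidef_inEigenbasis (ρ : DensityMatrix n) {X : Matrix n n ℂ}
    (hX : X.PosSemidef) : (ρ.inEigenbasis X).PosSemidef := by
  rw [ρ.inEigenbasis_apply]
  exact hX.conjTranspose_mul_mul_same _

/-- Lower bound for the skew information at a state with small operator norm. -/
theorem IsStandardOperatorMonotone.le_skewInformation (hf : IsStandardOperatorMonotone f)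
    (h0 : 0 < f 0) (ρ : DensityMatrix n) {H : Matrix n n ℂ} (hH : H.IsHermitian) {t : ℝ}
    (hρ : ((t : ℂ) • (1 : Matrix n n ℂ) - ρ.mat).PosSemidef) :
    f 0 / 2 * (t⁻¹ * ∑ i, ∑ j, ‖ρ.velocity H i j‖ ^ 2) ≤ skewInformation f ρ H := by
  have hle : ∀ i, ρ.eigenvalue i ≤ t := by
    intro i
    have h := ρ.posSemidef_inEigenbasis hρ
    rw [map_sub, map_smul, map_one, ρ.inEigenbasis_mat, Matrix.smul_one_eq_diagonal,
      Matrix.diagonal_sub, Matrix.posSemidef_diagonal_iff] at h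
    have := h i
    rwa [← Complex.ofReal_sub, Complex.zero_le_real, sub_nonneg] at this
  have hsum : ∑ i, ∑ j, ‖ρ.velocity H i j‖ ^ 2 =
      ∑ i, ∑ j, ‖ρ.inEigenbasis (ρ.velocity H) i j‖ ^ 2 := by
    rw [← Complex.ofReal_inj, ← trace_conjTranspose_mul_self_eq_sum,
      ← trace_conjTranspose_mul_self_eq_sum, ← ρ.map_conjTranspose_inEigenbasis, ← map_mul,
      ρ.trace_inEigenbasis]
  rw [skewInformation_eq_sum f ρ hH, hsum]
  refine mul_le_mul_of_nonneg_left ?_ (by positivity)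
  simp only [Finset.mul_sum]
  refine Finset.sum_le_sum fun i _ => Finset.sum_le_sum fun j _ => ?_
  by_cases hij : ρ.eigenvalue i = 0 ∧ ρ.eigenvalue j = 0
  · rw [ρ.inEigenbasis_velocity_eq_zero H i j hij.1 hij.2]
    simp
  · rw [morozovaChentsov_eq_inv]
    gcongr
    · exact hf.generatedMean_pos h0 (ρ.eigenvalue_nonneg i) (ρ.eigenvalue_nonneg j)
        (not_and_or.1 hij)
    · exact (hf.generatedMean_le_max (ρ.eigenvalue_nonneg i) (ρ.eigenvalue_nonneg j)).trans
        (max_le (hle i) (hle j))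

/-- Upper bound for the skew information: `∑ c_f |K|² ≤ Tr(K ρ⁻¹ K) ≤ Tr(K P⁻¹ K) / t` if
`t P ≤ ρ` and `K = i [H, ρ]`. -/
theorem IsStandardOperatorMonotone.skewInformation_le_of_smul_le
    (hf : IsStandardOperatorMonotone f) (ρ : DensityMatrix n) {H P Z : Matrix n n ℂ}
    (hH : H.IsHermitian) (hP : P.PosSemidef) {t : ℝ} (ht : 0 < t)
    (hρ : (ρ.mat - (t : ℂ) • P).PosSemidef) (hZ : ρ.velocity H = P * Z) :
    skewInformation f ρ H ≤ f 0 / 2 * ((Zᴴ * ρ.velocity H).trace.re / t) := by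
  have hK := ρ.inEigenbasis_isHermitian (ρ.velocity_isHermitian hH)
  have hQ := ρ.posSemidef_inEigenbasis hP
  have hρ' := ρ.posSemidef_inEigenbasis hρ
  have htr : (Zᴴ * ρ.velocity H).trace =
      ((ρ.inEigenbasis Z)ᴴ * ρ.inEigenbasis (ρ.velocity H)).trace := by
    rw [← ρ.map_conjTranspose_inEigenbasis, ← map_mul, ρ.trace_inEigenbasis]
  have hKZ := congrArg ρ.inEigenbasis hZ
  rw [map_mul] at hKZ
  rw [map_sub, map_smul, ρ.inEigenbasis_mat] at hρ'
  rw [skewInformation_eq_sum f ρ hH, htr]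
  refine mul_le_mul_of_nonneg_left ?_ (div_nonneg hf.zero_nonneg two_pos.le)
  set K := ρ.inEigenbasis (ρ.velocity H)
  set Y := ρ.inEigenbasis Z
  set Q := ρ.inEigenbasis P
  set r := ρ.eigenvalue
  have hr : ∀ i, 0 ≤ r i := ρ.eigenvalue_nonneg
  -- Since `t P ≤ ρ`, the kernel of `ρ` lies in that of `P`, and `K = P Z` vanishes on the
  -- corresponding rows. This makes the convention `0⁻¹ = 0` harmless in `S`.
  have hzero : ∀ i, r i = 0 → ∀ j, K i j = 0 := by
    intro i hi j
    have h1 : Q i i = 0 := by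
      have h2 := hρ'.diag_nonneg (i := i)
      rw [Matrix.sub_apply, Matrix.diagonal_apply_eq, hi, Matrix.smul_apply, Complex.ofReal_zero,
        zero_sub, smul_eq_mul, neg_nonneg] at h2
      have h3 : 0 ≤ (t : ℂ) * Q i i :=
        mul_nonneg (Complex.zero_le_real.2 ht.le) (hQ.diag_nonneg (i := i))
      have ht' : (t : ℂ) ≠ 0 := by exact_mod_cast ht.ne'
      exact (mul_eq_zero.1 (le_antisymm h2 h3)).resolve_left ht'
    rw [hKZ, Matrix.mul_apply]
    exact Finset.sum_eq_zero fun l _ => by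
      rw [hQ.apply_eq_zero_of_diag_eq_zero h1, zero_mul]
  have hzero' : ∀ j, r j = 0 → ∀ i, K i j = 0 := by
    intro j hj i
    rw [← hK.apply, hzero j hj, star_zero]
  set S := ∑ i, ∑ j, (r i)⁻¹ * ‖K i j‖ ^ 2 with hS
  have hsymm : ∑ i, ∑ j, (r j)⁻¹ * ‖K i j‖ ^ 2 = S := by
    rw [Finset.sum_comm, hS]
    refine Finset.sum_congr rfl fun i _ => Finset.sum_congr rfl fun j _ => ?_
    rw [← hK.apply, norm_star]
  have hcS : ∑ i, ∑ j, morozovaChentsov f (r i) (r j) * ‖K i j‖ ^ 2 ≤ S := by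
    have h : ∀ i j, morozovaChentsov f (r i) (r j) * ‖K i j‖ ^ 2 ≤
        ((r i)⁻¹ * ‖K i j‖ ^ 2 + (r j)⁻¹ * ‖K i j‖ ^ 2) / 2 := by
      intro i j
      by_cases hi : r i = 0
      · simp [hzero i hi]
      by_cases hj : r j = 0
      · simp [hzero' j hj]
      have := hf.inv_generatedMean_le ((hr i).lt_of_ne' hi) ((hr j).lt_of_ne' hj)
      rw [morozovaChentsov_eq_inv]
      nlinarith [sq_nonneg ‖K i j‖]
    have h1 := Finset.sum_le_sum fun i (_ : i ∈ Finset.univ) =>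
      Finset.sum_le_sum fun j (_ : j ∈ Finset.univ) => h i j
    simp only [← Finset.sum_div, Finset.sum_add_distrib] at h1
    rw [hsymm] at h1
    linarith
  refine hcS.trans ?_
  set W : Matrix n n ℂ := (Matrix.diagonal fun i => (((r i)⁻¹ : ℝ) : ℂ)) * K with hW
  have hWK : (Wᴴ * K).trace = (S : ℂ) := by
    rw [trace_conjTranspose_mul, hS, Complex.ofReal_sum]
    refine Finset.sum_congr rfl fun i _ => ?_
    rw [Complex.ofReal_sum]
    refine Finset.sum_congr rfl fun j _ => ?_
    rw [hW, Matrix.diagonal_mul, star_mul', RCLike.star_def, Complex.conj_ofReal, mul_assoc,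
      Complex.conj_mul', Complex.ofReal_mul, Complex.ofReal_pow]
  have hKW : (Kᴴ * W).trace = (S : ℂ) := by
    have := congrArg star hWK
    rwa [← Matrix.trace_conjTranspose, Matrix.conjTranspose_mul, Matrix.conjTranspose_conjTranspose,
      RCLike.star_def, Complex.conj_ofReal] at this
  have hDW : (Matrix.diagonal fun i => (r i : ℂ)) * W = K := by
    ext i j
    rw [Matrix.diagonal_mul, hW, Matrix.diagonal_mul, ← mul_assoc, ← Complex.ofReal_mul]
    by_cases hi : r i = 0
    · rw [hzero i hi, mul_zero]
    · rw [mul_inv_cancel₀ hi, Complex.ofReal_one, one_mul]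
  -- Here `W` plays `ρ⁻¹ K` and `Y` plays `P⁻¹ K`. `h1` reads `t Tr(Wᴴ Q W) ≤ S`; completing the
  -- square around `Y / t` gives `2 S / t ≤ Tr(Wᴴ Q W) + Tr(Yᴴ K) / t²`. Together, `S ≤ Tr(Yᴴ K) /
  -- t`.
  have h1 := (hρ'.conjTranspose_mul_mul_same W).trace_nonneg
  rw [Matrix.mul_sub, Matrix.sub_mul, Matrix.mul_assoc, hDW, Matrix.trace_sub, hWK, Matrix.mul_smul,
    Matrix.smul_mul, Matrix.trace_smul, smul_eq_mul] at h1
  have h2 := (hQ.conjTranspose_mul_mul_same (W - ((t⁻¹ : ℝ) : ℂ) • Y)).trace_nonneg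
  have hYQ : Yᴴ * Q = Kᴴ := by
    rw [hKZ, Matrix.conjTranspose_mul, hQ.1.eq]
  have e : ((W - ((t⁻¹ : ℝ) : ℂ) • Y)ᴴ * Q * (W - ((t⁻¹ : ℝ) : ℂ) • Y)).trace =
      (Wᴴ * Q * W).trace - ((2 * t⁻¹ * S : ℝ) : ℂ) +
        ((t⁻¹ * t⁻¹ : ℝ) : ℂ) * (Yᴴ * K).trace := by
    rw [Matrix.conjTranspose_sub, Matrix.conjTranspose_smul, RCLike.star_def, Complex.conj_ofReal]
    simp only [Matrix.sub_mul, Matrix.mul_sub, Matrix.smul_mul, Matrix.mul_smul, Matrix.trace_sub,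
      Matrix.trace_smul, smul_eq_mul]
    rw [hYQ, Matrix.mul_assoc Wᴴ Q Y, ← hKZ, ← hYQ, Matrix.mul_assoc Yᴴ Q Y, ← hKZ, hYQ, hWK, hKW]
    push_cast
    ring
  rw [e] at h2
  have h1' := (Complex.le_def.1 h1).1
  have h2' := (Complex.le_def.1 h2).1
  simp only [Complex.zero_re, Complex.sub_re, Complex.add_re, Complex.re_ofReal_mul,
    Complex.ofReal_re] at h1' h2'
  rw [le_div_iff₀ ht]
  have h3 := mul_nonneg (sq_nonneg t) h2'
  have e3 : t ^ 2 * ((Wᴴ * Q * W).trace.re - 2 * t⁻¹ * S + t⁻¹ * t⁻¹ * (Yᴴ * K).trace.re) =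
      t * (t * (Wᴴ * Q * W).trace.re) - 2 * t * S + (Yᴴ * K).trace.re := by
    field_simp
  rw [e3] at h3
  nlinarith [mul_nonneg ht.le h1']

end Bounds

/-! ### Clock states and the upper bound for their skew information. -/

section ClockStates

variable {n : Type*}

/-- The indicator that two levels are adjacent. -/
def adjacent (p q : ℕ) : ℝ := (if p = q + 1 then 1 else 0) + (if q = p + 1 then 1 else 0)

theorem adjacent_add_right (p q s : ℕ) : adjacent (p + s) (q + s) = adjacent p q := by
  unfold adjacent
  congr 2 <;> exact propext (by omega)

theorem sub_sq_mul_adjacent_sq (p q : ℕ) : ((p : ℝ) - q) ^ 2 * adjacent p q ^ 2 = adjacent p q := by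
  unfold adjacent
  by_cases h1 : p = q + 1
  · subst h1
    rw [if_pos rfl, if_neg (by omega)]
    push_cast
    ring
  · by_cases h2 : q = p + 1
    · subst h2
      rw [if_pos rfl, if_neg (by omega)]
      push_cast
      ring
    · simp [h1, h2]

/-- For energy levels `l`, the unnormalized mixture with density `1 + ε cos s` of the clock states
`∑_x exp(i s l(x)) |x⟩`. -/
noncomputable def clockMatrix (l : n → ℕ) (ε : ℝ) : Matrix n n ℂ :=
  Matrix.of fun x y => (((if l x = l y then 1 else 0) + ε / 2 * adjacent (l x) (l y) : ℝ) : ℂ)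

theorem clockMatrix_apply (l : n → ℕ) (ε : ℝ) (x y : n) :
    clockMatrix l ε x y =
      (((if l x = l y then 1 else 0) + ε / 2 * adjacent (l x) (l y) : ℝ) : ℂ) := rfl

variable [Fintype n]

/-- For `σ = ±1` the density is a perfect square, `1 + σ cos s = |1 + σ exp(i s)|² / 2`, and the `v
p` are the Fourier coefficients of the clock vector times `1 + σ exp(i s)`. -/
theorem posSemidef_clockMatrix_of_sq_eq_one (l : n → ℕ) {σ : ℝ} (hσ : σ ^ 2 = 1) :
    (clockMatrix l σ).PosSemidef := by
  let v : ℕ → n → ℂ := fun p x => (((if l x = p then 1 else 0) +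
    σ * (if l x + 1 = p then 1 else 0) : ℝ) : ℂ)
  -- Multiplying by `exp(i s)` raises the top level by one, hence `+ 2` in the range.
  have h : (∑ p ∈ Finset.range (Finset.univ.sup l + 2),
      Matrix.vecMulVec (v p) (star (v p))).PosSemidef :=
    Matrix.posSemidef_sum _ fun p _ => Matrix.posSemidef_vecMulVec_self_star _
  have h2 := h.smul (show (0 : ℂ) ≤ ((1 / 2 : ℝ) : ℂ) by
    rw [Complex.zero_le_real]; norm_num)
  convert h2 using 1
  ext x y
  have hx : l x ≤ Finset.univ.sup l := Finset.le_sup (Finset.mem_univ x)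
  have hy : l y ≤ Finset.univ.sup l := Finset.le_sup (Finset.mem_univ y)
  set M := Finset.univ.sup l
  have key : ∑ p ∈ Finset.range (M + 2),
      ((if l x = p then (1 : ℝ) else 0) + σ * (if l x + 1 = p then 1 else 0)) *
        ((if l y = p then 1 else 0) + σ * (if l y + 1 = p then 1 else 0)) =
      2 * ((if l x = l y then 1 else 0) + σ / 2 * adjacent (l x) (l y)) := by
    have e : ∀ p, ((if l x = p then (1 : ℝ) else 0) + σ * (if l x + 1 = p then 1 else 0)) *
        ((if l y = p then 1 else 0) + σ * (if l y + 1 = p then 1 else 0)) =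
        (if l x = p then ((if l y = p then 1 else 0) + σ * (if l y + 1 = p then 1 else 0)) else 0) +
        (if l x + 1 = p then
          σ * ((if l y = p then 1 else 0) + σ * (if l y + 1 = p then 1 else 0)) else 0) := by
      intro p
      split_ifs <;> ring
    rw [Finset.sum_congr rfl fun p _ => e p, Finset.sum_add_distrib, Finset.sum_ite_eq,
      Finset.sum_ite_eq, if_pos (Finset.mem_range.2 (by omega)),
      if_pos (Finset.mem_range.2 (by omega))]
    have e1 : (if l y = l x then (1 : ℝ) else 0) = if l x = l y then 1 else 0 := by
      simp only [eq_comm]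
    have e2 : (if l y + 1 = l x + 1 then (1 : ℝ) else 0) = if l x = l y then 1 else 0 := by
      simp only [eq_comm, Nat.add_right_cancel_iff]
    have e3 : (if l y + 1 = l x then (1 : ℝ) else 0) = if l x = l y + 1 then 1 else 0 := by
      simp only [eq_comm]
    rw [e1, e2, e3]
    unfold adjacent
    linear_combination (if l x = l y then (1 : ℝ) else 0) * hσ
  rw [Matrix.smul_apply, Matrix.sum_apply, clockMatrix_apply, smul_eq_mul]
  simp only [Matrix.vecMulVec_apply, Pi.star_apply, v, RCLike.star_def, Complex.conj_ofReal,
    ← Complex.ofReal_mul, ← Complex.ofReal_sum, key]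
  congr 1
  ring

/-- The density difference is `(1 + ε cos s) - (1 - ε) = ε (1 + cos s)`; the companion bound uses `ε
(1 - cos s)`. -/
theorem clockMatrix_sub_posSemidef (l : n → ℕ) {ε : ℝ} (hε : 0 ≤ ε) :
    (clockMatrix l ε - ((1 - ε : ℝ) : ℂ) • clockMatrix l 0).PosSemidef := by
  have h := (posSemidef_clockMatrix_of_sq_eq_one l (one_pow 2)).smul (Complex.zero_le_real.2 hε)
  convert h using 1
  ext x y
  simp only [Matrix.sub_apply, Matrix.smul_apply, clockMatrix_apply, smul_eq_mul,
    ← Complex.ofReal_mul, ← Complex.ofReal_sub]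
  congr 1
  ring

theorem sub_clockMatrix_posSemidef (l : n → ℕ) {ε : ℝ} (hε : 0 ≤ ε) :
    (((1 + ε : ℝ) : ℂ) • clockMatrix l 0 - clockMatrix l ε).PosSemidef := by
  have h := (posSemidef_clockMatrix_of_sq_eq_one l (σ := -1) (by norm_num)).smul
    (Complex.zero_le_real.2 hε)
  convert h using 1
  ext x y
  simp only [Matrix.sub_apply, Matrix.smul_apply, clockMatrix_apply, smul_eq_mul,
    ← Complex.ofReal_mul, ← Complex.ofReal_sub]
  congr 1
  ring

theorem posSemidef_clockMatrix_zero (l : n → ℕ) : (clockMatrix l 0).PosSemidef := by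
  have h := ((posSemidef_clockMatrix_of_sq_eq_one l (one_pow 2)).add
    (posSemidef_clockMatrix_of_sq_eq_one l (σ := -1) (by norm_num))).smul
    (show (0 : ℂ) ≤ ((1 / 2 : ℝ) : ℂ) by rw [Complex.zero_le_real]; norm_num)
  convert h using 1
  ext x y
  simp only [Matrix.add_apply, Matrix.smul_apply, clockMatrix_apply, smul_eq_mul,
    ← Complex.ofReal_mul, ← Complex.ofReal_add]
  congr 1
  ring

theorem posSemidef_clockMatrix (l : n → ℕ) {ε : ℝ} (hε : 0 ≤ ε) (hε1 : ε ≤ 1) :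
    (clockMatrix l ε).PosSemidef := by
  have h := (clockMatrix_sub_posSemidef l hε).add ((posSemidef_clockMatrix_zero l).smul
    (Complex.zero_le_real.2 (sub_nonneg.2 hε1)))
  rwa [sub_add_cancel] at h

variable [Nonempty n]

theorem natCast_card_pos : 0 < (Fintype.card n : ℝ) := by
  exact_mod_cast Fintype.card_pos

/-- The mixture with density `1 + ε cos s` of the clock states with energy levels `l`. -/
noncomputable def clockState (l : n → ℕ) (ε : ℝ) (hε : 0 ≤ ε) (hε1 : ε ≤ 1) : DensityMatrix n where
  mat := (((Fintype.card n : ℝ)⁻¹ : ℝ) : ℂ) • clockMatrix l ε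
  posSemidef := (posSemidef_clockMatrix l hε hε1).smul
    (Complex.zero_le_real.2 (inv_nonneg.2 (Nat.cast_nonneg _)))
  trace_eq_one := by
    have h : ∀ x, clockMatrix l ε x x = 1 := fun x => by simp [clockMatrix_apply, adjacent]
    have : (Fintype.card n : ℂ) ≠ 0 := by exact_mod_cast Fintype.card_ne_zero
    simp [Matrix.trace, h, this]

theorem clockState_mat_apply (l : n → ℕ) {ε : ℝ} (hε : 0 ≤ ε) (hε1 : ε ≤ 1) (x y : n) :
    (clockState l ε hε hε1).mat x y =
      (((Fintype.card n : ℝ)⁻¹ : ℝ) : ℂ) * clockMatrix l ε x y := rfl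

/-- The Hamiltonian with energy levels `l`. -/
def levelHamiltonian [DecidableEq n] (l : n → ℕ) : Matrix n n ℂ :=
  Matrix.diagonal fun x => ((l x : ℝ) : ℂ)

variable [DecidableEq n]

theorem clockState_velocity_apply (l : n → ℕ) {ε : ℝ} (hε : 0 ≤ ε) (hε1 : ε ≤ 1) (x y : n) :
    (clockState l ε hε hε1).velocity (levelHamiltonian l) x y = Complex.I *
      (((Fintype.card n : ℝ)⁻¹ * (ε / 2 * ((l x - l y) * adjacent (l x) (l y))) : ℝ) : ℂ) := by
  have h : ((l x : ℝ) - l y) * (if l x = l y then 1 else 0) = 0 := by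
    split_ifs with h
    · rw [h, sub_self, zero_mul]
    · rw [mul_zero]
  unfold DensityMatrix.velocity levelHamiltonian
  rw [Matrix.smul_apply, Matrix.sub_apply, Matrix.diagonal_mul, Matrix.mul_diagonal,
    clockState_mat_apply, clockMatrix_apply, smul_eq_mul, ← Complex.ofReal_mul,
    ← Complex.ofReal_mul, ← Complex.ofReal_mul, ← Complex.ofReal_sub]
  congr 2
  linear_combination (Fintype.card n : ℝ)⁻¹ * h

theorem clockState_norm_velocity_sq (l : n → ℕ) {ε : ℝ} (hε : 0 ≤ ε) (hε1 : ε ≤ 1) (x y : n) :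
    ‖(clockState l ε hε hε1).velocity (levelHamiltonian l) x y‖ ^ 2 =
      ((Fintype.card n : ℝ)⁻¹ * (ε / 2)) ^ 2 * adjacent (l x) (l y) := by
  rw [clockState_velocity_apply, norm_mul, Complex.norm_I, one_mul, Complex.norm_real,
    Real.norm_eq_abs, sq_abs]
  linear_combination ((Fintype.card n : ℝ)⁻¹ * (ε / 2)) ^ 2 * sub_sq_mul_adjacent_sq (l x) (l y)

/-- The number of states in a level. -/
noncomputable def levelCard (l : n → ℕ) (p : ℕ) : ℝ := ∑ z, if l z = p then 1 else 0

omit [Nonempty n] [DecidableEq n] in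
theorem levelCard_pos (l : n → ℕ) (x : n) : 0 < levelCard l (l x) :=
  Finset.sum_pos' (fun _ _ => by positivity) ⟨x, Finset.mem_univ x, by simp⟩

omit [Nonempty n] [DecidableEq n] in
theorem sum_inv_levelCard_le (l : n → ℕ) (p : ℕ) :
    ∑ x, (levelCard l (l x))⁻¹ * (if l x = p then 1 else 0) ≤ 1 := by
  have h : ∀ x, (levelCard l (l x))⁻¹ * (if l x = p then (1 : ℝ) else 0) =
      (levelCard l p)⁻¹ * (if l x = p then 1 else 0) := by
    intro x
    split_ifs with h
    · rw [h]
    · rw [mul_zero, mul_zero]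
  rw [Finset.sum_congr rfl fun x _ => h x, ← Finset.mul_sum]
  exact inv_mul_le_one

omit [Nonempty n] [DecidableEq n] in
-- For fixed `y`, each level adjacent to that of `y` contributes at most `1`, however degenerate it
-- is, and there are at most two such levels.
theorem sum_inv_levelCard_mul_adjacent_le (l : n → ℕ) :
    ∑ x, ∑ y, (levelCard l (l x))⁻¹ * adjacent (l x) (l y) ≤ 2 * Fintype.card n := by
  rw [Finset.sum_comm]
  have h : ∀ y, ∑ x, (levelCard l (l x))⁻¹ * adjacent (l x) (l y) ≤ 2 := by
    intro y
    simp only [adjacent, mul_add, Finset.sum_add_distrib]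
    have h1 := sum_inv_levelCard_le l (l y + 1)
    have h2 : ∑ x, (levelCard l (l x))⁻¹ * (if l y = l x + 1 then 1 else 0) ≤ 1 := by
      rcases hy : l y with _ | q
      · simp
      · refine le_trans (le_of_eq ?_) (sum_inv_levelCard_le l q)
        refine Finset.sum_congr rfl fun x _ => ?_
        congr 2
        exact propext (by omega)
    linarith
  refine (Finset.sum_le_sum fun y (_ : y ∈ Finset.univ) => h y).trans ?_
  rw [Finset.sum_const, Finset.card_univ, nsmul_eq_mul, mul_comm]

omit [Fintype n] [Nonempty n] in
theorem levelHamiltonian_isHermitian (l : n → ℕ) : (levelHamiltonian l).IsHermitian :=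
  isHermitian_diagonal_ofReal fun x => (l x : ℝ)

variable {f : ℝ → ℝ}

/-- The bound depends neither on the dimension nor on the levels, so it does not grow with the
number of subsystems. The comparison operator is the state at `ε = 0`, which is at most the clock
state divided by `1 - ε`. -/
theorem IsStandardOperatorMonotone.skewInformation_clockState_le
    (hf : IsStandardOperatorMonotone f) (l : n → ℕ) {ε : ℝ} (hε : 0 ≤ ε) (hε1 : ε < 1) :
    skewInformation f (clockState l ε hε hε1.le) (levelHamiltonian l) ≤
      f 0 / 2 * (ε ^ 2 / 2 / (1 - ε)) := by
  set N := (Fintype.card n : ℝ) with hN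
  have hN0 : 0 < N := natCast_card_pos
  -- The comparison operator sums over each level, and the velocity is constant on levels; dividing
  -- by the level's cardinality solves `K = P Z`.
  let Z : Matrix n n ℂ := Matrix.of fun x y => Complex.I *
    (((levelCard l (l x))⁻¹ * (ε / 2 * ((l x - l y) * adjacent (l x) (l y))) : ℝ) : ℂ)
  have hZ_apply : ∀ x y, Z x y = Complex.I *
      (((levelCard l (l x))⁻¹ * (ε / 2 * ((l x - l y) * adjacent (l x) (l y))) : ℝ) : ℂ) :=
    fun _ _ => rfl
  have hP : (((N⁻¹ : ℝ) : ℂ) • clockMatrix l 0).PosSemidef :=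
    (posSemidef_clockMatrix_zero l).smul (Complex.zero_le_real.2 (inv_nonneg.2 hN0.le))
  have hρ : ((clockState l ε hε hε1.le).mat -
      ((1 - ε : ℝ) : ℂ) • (((N⁻¹ : ℝ) : ℂ) • clockMatrix l 0)).PosSemidef := by
    have h := (clockMatrix_sub_posSemidef l hε).smul
      (Complex.zero_le_real.2 (inv_nonneg.2 hN0.le))
    rwa [smul_sub, smul_comm] at h
  have hZ : (clockState l ε hε hε1.le).velocity (levelHamiltonian l) =
      (((N⁻¹ : ℝ) : ℂ) • clockMatrix l 0) * Z := by
    ext x y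
    rw [clockState_velocity_apply, ← hN, Matrix.smul_mul, Matrix.smul_apply, Matrix.mul_apply,
      smul_eq_mul]
    have h : ∀ z, clockMatrix l 0 x z * Z z y = Complex.I * (((levelCard l (l x))⁻¹ *
        (ε / 2 * ((l x - l y) * adjacent (l x) (l y))) *
          (if l z = l x then 1 else 0) : ℝ) : ℂ) := by
      intro z
      rw [clockMatrix_apply, hZ_apply, zero_div, zero_mul, add_zero]
      by_cases hz : l z = l x
      · rw [if_pos hz.symm, if_pos hz, hz, Complex.ofReal_one, one_mul, mul_one]
      · rw [if_neg (Ne.symm hz), if_neg hz]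
        simp
    rw [Finset.sum_congr rfl fun z _ => h z, ← Finset.mul_sum, ← Complex.ofReal_sum,
      ← Finset.mul_sum, mul_left_comm ((N⁻¹ : ℝ) : ℂ), ← Complex.ofReal_mul]
    congr 2
    have := (levelCard_pos l x).ne'
    change _ = N⁻¹ * (_ * levelCard l (l x))
    field_simp
  refine (hf.skewInformation_le_of_smul_le _ (levelHamiltonian_isHermitian l) hP
    (sub_pos.2 hε1) hρ hZ).trans ?_
  refine mul_le_mul_of_nonneg_left ?_ (div_nonneg hf.zero_nonneg two_pos.le)
  refine div_le_div_of_nonneg_right ?_ (sub_pos.2 hε1).le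
  have htr : (Zᴴ * (clockState l ε hε hε1.le).velocity (levelHamiltonian l)).trace =
      ((N⁻¹ * (ε / 2) ^ 2 * ∑ x, ∑ y, (levelCard l (l x))⁻¹ * adjacent (l x) (l y) : ℝ) : ℂ) := by
    rw [trace_conjTranspose_mul, Finset.mul_sum, Complex.ofReal_sum]
    refine Finset.sum_congr rfl fun x _ => ?_
    rw [Finset.mul_sum, Complex.ofReal_sum]
    refine Finset.sum_congr rfl fun y _ => ?_
    have e : N⁻¹ * (ε / 2) ^ 2 * ((levelCard l (l x))⁻¹ * adjacent (l x) (l y)) =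
        (levelCard l (l x))⁻¹ * (ε / 2 * ((l x - l y) * adjacent (l x) (l y))) *
          (N⁻¹ * (ε / 2 * ((l x - l y) * adjacent (l x) (l y)))) := by
      linear_combination (-N⁻¹ * (ε / 2) ^ 2 * (levelCard l (l x))⁻¹) *
        sub_sq_mul_adjacent_sq (l x) (l y)
    rw [clockState_velocity_apply, hZ_apply, star_mul', RCLike.star_def, Complex.conj_I,
      Complex.conj_ofReal, ← hN, e]
    generalize N⁻¹ * (ε / 2 * (((l x : ℝ) - l y) * adjacent (l x) (l y))) = u
    generalize (levelCard l (l x))⁻¹ * (ε / 2 * (((l x : ℝ) - l y) * adjacent (l x) (l y))) = v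
    rw [Complex.ofReal_mul]
    linear_combination (-(u * v : ℂ)) * Complex.I_mul_I
  rw [htr, Complex.ofReal_re]
  calc _ ≤ N⁻¹ * (ε / 2) ^ 2 * (2 * N) := by
        gcongr
        exact sum_inv_levelCard_mul_adjacent_le l
    _ = ε ^ 2 / 2 := by field_simp

end ClockStates

/-! ### Ladders of clocks and optimality of the constant. -/

section Ladder

theorem clockMatrix_val_zero (d : ℕ) : clockMatrix (Fin.val : Fin d → ℕ) 0 = 1 := by
  ext x y
  rw [clockMatrix_apply, Matrix.one_apply, zero_div, zero_mul, add_zero]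
  split_ifs with h1 h2 h2
  · rfl
  · exact absurd (Fin.ext h1) h2
  · exact absurd (congrArg Fin.val h2) h1
  · rfl

theorem two_mul_le_sum_adjacent (d : ℕ) :
    2 * (d : ℝ) ≤ ∑ x : Fin (d + 1), ∑ y : Fin (d + 1), adjacent x y := by
  have h : (d : ℝ) ≤ ∑ y : Fin (d + 1), ∑ x : Fin (d + 1),
      if (x : ℕ) = y + 1 then (1 : ℝ) else 0 := by
    rw [Fin.sum_univ_castSucc]
    have h1 : ∀ y : Fin d, (1 : ℝ) ≤ ∑ x : Fin (d + 1),
        if (x : ℕ) = (y.castSucc : ℕ) + 1 then (1 : ℝ) else 0 := by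
      intro y
      have := Finset.single_le_sum (f := fun x : Fin (d + 1) =>
        if (x : ℕ) = (y.castSucc : ℕ) + 1 then (1 : ℝ) else 0) (fun _ _ => by positivity)
        (Finset.mem_univ y.succ)
      simpa using this
    have h2 := Finset.sum_le_sum fun y (_ : y ∈ Finset.univ) => h1 y
    rw [Finset.sum_const, Finset.card_univ, Fintype.card_fin, nsmul_eq_mul, mul_one] at h2
    refine h2.trans (le_add_of_nonneg_right ?_)
    exact Finset.sum_nonneg fun _ _ => by positivity
  have h' := h
  rw [Finset.sum_comm] at h'
  simp only [adjacent, Finset.sum_add_distrib]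
  linarith

/-- The ladder is nondegenerate, so the state is at most `(1 + ε)/(d + 1)` times the identity. The
factor `d/(d + 1)` is the boundary loss: `d` neighbouring pairs among `d + 1` levels. -/
theorem IsStandardOperatorMonotone.le_skewInformation_clockState {f : ℝ → ℝ}
    (hf : IsStandardOperatorMonotone f) (h0 : 0 < f 0) (d : ℕ) {ε : ℝ} (hε : 0 ≤ ε) (hε1 : ε ≤ 1) :
    f 0 / 2 * (ε ^ 2 / 2 * (d / ((d + 1) * (1 + ε)))) ≤
      skewInformation f (clockState (Fin.val : Fin (d + 1) → ℕ) ε hε hε1)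
        (levelHamiltonian Fin.val) := by
  set N := (Fintype.card (Fin (d + 1)) : ℝ) with hN
  have hN0 : 0 < N := natCast_card_pos
  have hNd : N = d + 1 := by simp [hN]
  have hρ : (((N⁻¹ * (1 + ε) : ℝ) : ℂ) • (1 : Matrix (Fin (d + 1)) (Fin (d + 1)) ℂ) -
      (clockState (Fin.val : Fin (d + 1) → ℕ) ε hε hε1).mat).PosSemidef := by
    have h := (sub_clockMatrix_posSemidef (Fin.val : Fin (d + 1) → ℕ) hε).smul
      (Complex.zero_le_real.2 (inv_nonneg.2 hN0.le))
    rwa [smul_sub, smul_smul, ← Complex.ofReal_mul, clockMatrix_val_zero] at h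
  refine le_trans ?_ (hf.le_skewInformation h0 _ (levelHamiltonian_isHermitian _) hρ)
  refine mul_le_mul_of_nonneg_left ?_ (by positivity)
  simp only [clockState_norm_velocity_sq, ← Finset.mul_sum]
  calc _ = (N⁻¹ * (1 + ε))⁻¹ * ((N⁻¹ * (ε / 2)) ^ 2 * (2 * d)) := by
        rw [← hNd]
        field_simp
    _ ≤ _ := by
        rw [← hN]
        gcongr
        exact two_mul_le_sum_adjacent d

variable {k : ℕ}

theorem DensityMatrix.ext_mat {n : Type*} [Fintype n] {ρ σ : DensityMatrix n}
    (h : ρ.mat = σ.mat) : ρ = σ := by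
  cases ρ
  cases σ
  congr

theorem additiveHamiltonian_levelHamiltonian (k d : ℕ) :
    additiveHamiltonian (fun _ : Fin k => levelHamiltonian (Fin.val : Fin (d + 1) → ℕ)) =
      levelHamiltonian fun x : Fin k → Fin (d + 1) => ∑ j, (x j : ℕ) := by
  rw [additiveHamiltonian_eq_sum]
  ext x y
  rw [Matrix.sum_apply]
  unfold levelHamiltonian
  by_cases hxy : x = y
  · subst hxy
    simp [localOperator_apply]
  · rw [Matrix.diagonal_apply_ne _ hxy]
    refine Finset.sum_eq_zero fun j _ => ?_
    rw [localOperator_apply]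
    by_cases hj : x j = y j
    · rw [Matrix.one_apply_ne, mul_zero]
      intro h
      apply hxy
      ext i
      by_cases hi : i = j
      · rw [hi, hj]
      · rw [congrFun h ⟨i, hi⟩]
    · rw [Matrix.diagonal_apply_ne _ hj, zero_mul]

/-- Matrix entries depend only on energy differences, and fixing the other coordinates shifts both
energies equally. So all terms of the partial trace coincide. -/
theorem reducedState_clockState (k d : ℕ) {ε : ℝ} (hε : 0 ≤ ε) (hε1 : ε ≤ 1) (j : Fin k) :
    reducedState (clockState (fun x : Fin k → Fin (d + 1) => ∑ j, (x j : ℕ)) ε hε hε1) j =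
      clockState (Fin.val : Fin (d + 1) → ℕ) ε hε hε1 := by
  apply DensityMatrix.ext_mat
  ext a b
  simp only [reducedState, clockState, Matrix.of_apply, Matrix.smul_apply, smul_eq_mul]
  have hsum : ∀ (c : Fin (d + 1)) (w : ∀ _ : {i // i ≠ j}, Fin (d + 1)),
      ∑ i, (((Equiv.piSplitAt j fun _ : Fin k => Fin (d + 1)).symm (c, w) i : Fin (d + 1)) : ℕ) =
        c + ∑ i, (w i : ℕ) := by
    intro c w
    rw [← Finset.add_sum_erase _ _ (Finset.mem_univ j)]
    congr 1
    · simp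
    · refine (Finset.sum_subtype (p := fun i => i ≠ j) (Finset.univ.erase j) (by simp)
        (fun i => (((Equiv.piSplitAt j fun _ : Fin k => Fin (d + 1)).symm (c, w) i :
          Fin (d + 1)) : ℕ))).trans (Finset.sum_congr rfl fun i _ => ?_)
      simp [Equiv.piSplitAt_symm_apply, i.2]
  have hentry : ∀ w : ∀ _ : {i // i ≠ j}, Fin (d + 1),
      clockMatrix (fun x : Fin k → Fin (d + 1) => ∑ j, (x j : ℕ)) ε
        ((Equiv.piSplitAt j fun _ : Fin k => Fin (d + 1)).symm (a, w))
        ((Equiv.piSplitAt j fun _ : Fin k => Fin (d + 1)).symm (b, w)) =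
      clockMatrix (Fin.val : Fin (d + 1) → ℕ) ε a b := by
    intro w
    simp only [clockMatrix_apply, hsum, adjacent_add_right, Nat.add_right_cancel_iff]
  rw [Finset.sum_congr rfl fun w _ => by rw [hentry w], Finset.sum_const, Finset.card_univ,
    nsmul_eq_mul, ← mul_assoc]
  congr 1
  rw [Fintype.card_congr (Equiv.piSplitAt j fun _ : Fin k => Fin (d + 1)), Fintype.card_prod]
  have hR : (Fintype.card (∀ _ : {i // i ≠ j}, Fin (d + 1)) : ℂ) ≠ 0 := by
    exact_mod_cast Fintype.card_ne_zero
  have hd : (Fintype.card (Fin (d + 1)) : ℂ) ≠ 0 := by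
    exact_mod_cast Fintype.card_ne_zero
  push_cast
  field_simp

theorem IsStandardOperatorMonotone.le_one_div_of_superadditive {f : ℝ → ℝ}
    (hf : IsStandardOperatorMonotone f) (h0 : 0 < f 0) (hk : 1 ≤ k) {β : ℝ}
    (h : ∀ (ι : Fin k → Type) [∀ j, Fintype (ι j)] [∀ j, DecidableEq (ι j)]
      (ρ : DensityMatrix (∀ j, ι j)) (H : ∀ j, Matrix (ι j) (ι j) ℂ),
      (∀ j, (H j).IsHermitian) →
      β * ∑ j, skewInformation f (reducedState ρ j) (H j)
        ≤ skewInformation f ρ (additiveHamiltonian H)) : β ≤ 1 / (k : ℝ) := by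
  have hk' : 0 < (k : ℝ) := by exact_mod_cast hk
  rw [le_div_iff₀ hk']
  by_contra! hβ
  have hβ0 : 0 < β := pos_of_mul_pos_left (one_pos.trans hβ) hk'.le
  -- With `ε = 1/(d+1)` the two bounds give `β k d² ≤ (d+1)(d+2) ≤ d² + 5d`, that is `(β k - 1) d ≤
  -- 5`, contradicting this choice of `d`.
  obtain ⟨d, hd⟩ := exists_nat_gt (5 / (β * k - 1))
  have hδ : 0 < β * k - 1 := sub_pos.2 hβ
  rw [div_lt_iff₀ hδ] at hd
  have hd1 : (1 : ℝ) ≤ d := by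
    have : d ≠ 0 := by
      rintro rfl
      simp at hd
      linarith
    exact_mod_cast Nat.one_le_iff_ne_zero.2 this
  set ε : ℝ := 1 / (d + 1) with hεdef
  have hε : 0 < ε := by positivity
  have hε1 : ε < 1 := by
    rw [hεdef, div_lt_one (by positivity)]
    linarith
  have h1 := h (fun _ => Fin (d + 1)) (clockState (fun x => ∑ j, (x j : ℕ)) ε hε.le hε1.le)
    (fun _ => levelHamiltonian Fin.val) (fun _ => levelHamiltonian_isHermitian _)
  simp only [reducedState_clockState, Finset.sum_const, Finset.card_univ, Fintype.card_fin,
    nsmul_eq_mul, additiveHamiltonian_levelHamiltonian] at h1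
  have h2 := h1.trans (hf.skewInformation_clockState_le _ hε.le hε1)
  have h3 := mul_le_mul_of_nonneg_left (hf.le_skewInformation_clockState h0 d hε.le hε1.le)
    (mul_pos hβ0 hk').le
  rw [mul_assoc β, mul_assoc β] at h3
  have h4 := h3.trans h2
  have e1 : β * (k * (f 0 / 2 * (ε ^ 2 / 2 * (d / ((d + 1) * (1 + ε)))))) =
      (f 0 / 2 * (ε ^ 2 / 2)) * (β * k * (d / (d + 2))) := by
    have : (d + 1) * (1 + ε) = d + 2 := by
      rw [hεdef]
      field_simp
      ring
    rw [this]
    ring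
  have e2 : f 0 / 2 * (ε ^ 2 / 2 / (1 - ε)) = (f 0 / 2 * (ε ^ 2 / 2)) * ((d + 1) / d) := by
    have : 1 - ε = d / (d + 1) := by
      rw [hεdef]
      field_simp
      ring
    rw [this]
    field_simp
  rw [e1, e2] at h4
  have h5 := le_of_mul_le_mul_left h4 (by positivity)
  rw [mul_div_assoc', div_le_div_iff₀ (by positivity) (by positivity)] at h5
  nlinarith

end Ladder

/-! ### The Wigner–Yanase case. -/

section WignerYanase

open scoped MatrixOrder Matrix.Norms.L2Operator in
theorem posSemidef_cfc_sqrt_sub {n : Type*} [Fintype n] [DecidableEq n] {A B : Matrix n n ℂ}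
    (hA : A.PosSemidef) (hAB : (B - A).PosSemidef) :
    (cfc Real.sqrt B - cfc Real.sqrt A).PosSemidef := by
  have hB : B.PosSemidef := by simpa using hAB.add hA
  have h := CFC.sqrt_le_sqrt A B (Matrix.le_iff.2 hAB)
  rw [CFC.sqrt_eq_real_sqrt A (Matrix.nonneg_iff_posSemidef.2 hA),
    CFC.sqrt_eq_real_sqrt B (Matrix.nonneg_iff_posSemidef.2 hB), cfcₙ_eq_cfc, cfcₙ_eq_cfc] at h
  exact Matrix.le_iff.1 h

/-- The standard operator monotone function `((1 + √x) / 2)²` of the Wigner-Yanase metric. -/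
noncomputable def wignerYanaseFunction (x : ℝ) : ℝ := 1 / 4 + (1 / 2 * √x + 1 / 4 * x)

theorem cfc_wignerYanaseFunction {n : Type*} [Fintype n] [DecidableEq n] {A : Matrix n n ℂ}
    (hA : A.IsHermitian) : cfc wignerYanaseFunction A =
      algebraMap ℝ _ (1 / 4) + ((1 / 2 : ℝ) • cfc Real.sqrt A + (1 / 4 : ℝ) • A) := by
  have hA' : IsSelfAdjoint A := hA
  unfold wignerYanaseFunction
  rw [cfc_const_add (1 / 4 : ℝ) (fun x => 1 / 2 * √x + 1 / 4 * x) A (by fun_prop) hA',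
    cfc_add A (fun x => 1 / 2 * √x) (fun x => 1 / 4 * x) (by fun_prop) (by fun_prop),
    cfc_const_mul (1 / 2 : ℝ) Real.sqrt A (by fun_prop), cfc_const_mul_id (1 / 4 : ℝ) A hA']

theorem isStandardOperatorMonotone_wignerYanaseFunction :
    IsStandardOperatorMonotone wignerYanaseFunction where
  monotone n A B hA hAB := by
    have hB : B.PosSemidef := by simpa using hAB.add hA
    have h := ((posSemidef_cfc_sqrt_sub hA hAB).smul (show (0 : ℝ) ≤ 1 / 2 by norm_num)).add
      (hAB.smul (show (0 : ℝ) ≤ 1 / 4 by norm_num))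
    rw [cfc_wignerYanaseFunction hA.1, cfc_wignerYanaseFunction hB.1]
    convert h using 1
    rw [smul_sub, smul_sub]
    abel
  symmetric x hx := by
    have h1 : √x * √x = x := Real.mul_self_sqrt hx.le
    have h2 : √x ≠ 0 := (Real.sqrt_pos.2 hx).ne'
    have h3 : x * (√x)⁻¹ = √x := by
      nth_rewrite 1 [← h1]
      field_simp
    have h4 : x * (1 / x) = 1 := mul_one_div_cancel hx.ne'
    unfold wignerYanaseFunction
    rw [Real.sqrt_div zero_le_one, Real.sqrt_one, one_div (√x)]
    linear_combination (-1 / 2) * h3 - 1 / 4 * h4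
  normalized := by
    unfold wignerYanaseFunction
    norm_num
  tendsto_zero := by
    have : Continuous wignerYanaseFunction := by
      unfold wignerYanaseFunction
      fun_prop
    exact (this.tendsto 0).mono_left nhdsWithin_le_nhds

theorem wignerYanaseFunction_zero : wignerYanaseFunction 0 = 1 / 4 := by
  simp [wignerYanaseFunction]

theorem generatedMean_wignerYanaseFunction {x y : ℝ} (hx : 0 ≤ x) (hy : 0 ≤ y) :
    generatedMean wignerYanaseFunction x y = (√x + √y) ^ 2 / 4 := by
  unfold generatedMean
  split_ifs with h
  · rw [h, wignerYanaseFunction_zero, Real.sqrt_zero, add_zero, Real.sq_sqrt hx]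
    ring
  · have h1 : √x ^ 2 = x := Real.sq_sqrt hx
    have h2 : √y ^ 2 = y := Real.sq_sqrt hy
    have h3 : √y ≠ 0 := (Real.sqrt_pos.2 (hy.lt_of_ne' h)).ne'
    unfold wignerYanaseFunction
    have e : x / y = √x ^ 2 / √y ^ 2 := by rw [h1, h2]
    rw [Real.sqrt_div hx, e]
    nth_rewrite 1 [← h2]
    field_simp
    ring

/-- Here `c_f(x, y) = 4/(√x + √y)²`, which cancels one factor of `y - x = (√y - √x)(√x + √y)`; the
prefactor `1/4` is `f(0)`. -/
theorem wignerYanase_weight {x y : ℝ} (hx : 0 ≤ x) (hy : 0 ≤ y) :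
    (1 / 4) * (morozovaChentsov wignerYanaseFunction x y * (y - x) ^ 2) = (√y - √x) ^ 2 := by
  have h1 : √x ^ 2 = x := Real.sq_sqrt hx
  have h2 : √y ^ 2 = y := Real.sq_sqrt hy
  have e : y - x = (√y - √x) * (√x + √y) := by linear_combination h1 - h2
  rw [morozovaChentsov_eq_inv, generatedMean_wignerYanaseFunction hx hy, e]
  by_cases h : √x + √y = 0
  · have hx0 : √x = 0 := by linarith [Real.sqrt_nonneg x, Real.sqrt_nonneg y]
    have hy0 : √y = 0 := by linarith [Real.sqrt_nonneg x, Real.sqrt_nonneg y]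
    simp [hx0, hy0]
  · field_simp

/-- The Wigner-Yanase skew information is the metric-adjusted one for `((1 + √x) / 2)²`. -/
theorem wignerYanase_eq_skewInformation {n : Type*} [Fintype n] [DecidableEq n]
    (ρ : DensityMatrix n) {H : Matrix n n ℂ} (hH : H.IsHermitian) :
    wignerYanase ρ H = skewInformation wignerYanaseFunction ρ H := by
  rw [skewInformation_eq_sum _ ρ hH, wignerYanaseFunction_zero]
  have hG := ρ.inEigenbasis_isHermitian hH
  have hsqrt : ρ.inEigenbasis (cfc Real.sqrt ρ.mat) =
      Matrix.diagonal fun i => ((√(ρ.eigenvalue i) : ℝ) : ℂ) := by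
    have h : ρ.mat * ρ.posSemidef.isHermitian.eigenvectorUnitary =
        ρ.posSemidef.isHermitian.eigenvectorUnitary *
          Matrix.diagonal fun i => (ρ.eigenvalue i : ℂ) := by
      rw [← ρ.inEigenbasis_mat, ρ.inEigenbasis_apply, ← mul_assoc, ← mul_assoc,
        Unitary.mul_star_self_of_mem (ρ.posSemidef.isHermitian.eigenvectorUnitary.2), one_mul]
    rw [ρ.inEigenbasis_apply, mul_assoc, cfc_mul_eq_mul_cfc ρ.posSemidef.isHermitian
      (isHermitian_diagonal_ofReal _) h, cfc_diagonal, ← mul_assoc,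
      Unitary.star_mul_self_of_mem (ρ.posSemidef.isHermitian.eigenvectorUnitary.2), one_mul]
  unfold wignerYanase
  set R := cfc Real.sqrt ρ.mat
  set G := ρ.inEigenbasis H with hGdef
  have hC : ∀ i j, ρ.inEigenbasis (R * H - H * R) i j =
      ((√(ρ.eigenvalue i) - √(ρ.eigenvalue j) : ℝ) : ℂ) * G i j := by
    intro i j
    rw [map_sub, map_mul, map_mul, hsqrt, Matrix.sub_apply, Matrix.diagonal_mul,
      Matrix.mul_diagonal, Complex.ofReal_sub]
    ring
  have htr : ((R * H - H * R) ^ 2).trace =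
      ((∑ i, ∑ j, -((√(ρ.eigenvalue j) - √(ρ.eigenvalue i)) ^ 2 * ‖G i j‖ ^ 2) : ℝ) : ℂ) := by
    rw [← ρ.trace_inEigenbasis, map_pow, pow_two, Matrix.trace, Complex.ofReal_sum]
    refine Finset.sum_congr rfl fun i _ => ?_
    rw [Matrix.diag_apply, Matrix.mul_apply, Complex.ofReal_sum]
    refine Finset.sum_congr rfl fun j _ => ?_
    rw [hC, hC, ← hG.apply j i, Complex.ofReal_neg, Complex.ofReal_mul, Complex.ofReal_pow,
      Complex.ofReal_pow, ← Complex.mul_conj', RCLike.star_def]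
    push_cast
    ring
  rw [htr, Complex.ofReal_re]
  simp only [Finset.mul_sum]
  refine Finset.sum_congr rfl fun i _ => Finset.sum_congr rfl fun j _ => ?_
  have hnorm : ‖ρ.inEigenbasis (ρ.velocity H) i j‖ ^ 2 =
      (ρ.eigenvalue j - ρ.eigenvalue i) ^ 2 * ‖G i j‖ ^ 2 := by
    rw [ρ.inEigenbasis_velocity_apply, norm_mul, norm_mul, Complex.norm_I, one_mul,
      ← Complex.ofReal_sub, Complex.norm_real, mul_pow, Real.norm_eq_abs, sq_abs]
  rw [hnorm, ← wignerYanase_weight (ρ.eigenvalue_nonneg i) (ρ.eigenvalue_nonneg j)]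
  ring

end WignerYanase

theorem theorem2 (k : ℕ) (hk : 1 ≤ k) :
    (∀ f : ℝ → ℝ, IsStandardOperatorMonotone f →
      (∀ (ι : Fin k → Type) [∀ j, Fintype (ι j)] [∀ j, DecidableEq (ι j)]
          (ρ : DensityMatrix (∀ j, ι j)) (H : ∀ j, Matrix (ι j) (ι j) ℂ),
          (∀ j, (H j).IsHermitian) →
          (1 / (k : ℝ)) * ∑ j, skewInformation f (reducedState ρ j) (H j)
            ≤ skewInformation f ρ (additiveHamiltonian H)) ∧
      (0 < f 0 →
        IsGreatest {β : ℝ | ∀ (ι : Fin k → Type) [∀ j, Fintype (ι j)] [∀ j, DecidableEq (ι j)]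
          (ρ : DensityMatrix (∀ j, ι j)) (H : ∀ j, Matrix (ι j) (ι j) ℂ),
          (∀ j, (H j).IsHermitian) →
          β * ∑ j, skewInformation f (reducedState ρ j) (H j)
            ≤ skewInformation f ρ (additiveHamiltonian H)} (1 / (k : ℝ)))) ∧
    IsGreatest {β : ℝ | ∀ (ι : Fin k → Type) [∀ j, Fintype (ι j)] [∀ j, DecidableEq (ι j)]
      (ρ : DensityMatrix (∀ j, ι j)) (H : ∀ j, Matrix (ι j) (ι j) ℂ),
      (∀ j, (H j).IsHermitian) →
      β * ∑ j, wignerYanase (reducedState ρ j) (H j)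
        ≤ wignerYanase ρ (additiveHamiltonian H)} (1 / (k : ℝ)) := by
  have hWY := isStandardOperatorMonotone_wignerYanaseFunction
  have hWY0 : 0 < wignerYanaseFunction 0 := by
    rw [wignerYanaseFunction_zero]
    norm_num
  refine ⟨fun f hf => ⟨fun ι _ _ ρ H hH => hf.weak_superadditivity hk ρ hH, fun h0 =>
    ⟨fun ι _ _ ρ H hH => hf.weak_superadditivity hk ρ hH,
      fun β hβ => hf.le_one_div_of_superadditive h0 hk hβ⟩⟩, fun ι _ _ ρ H hH => ?_,
    fun β hβ => hWY.le_one_div_of_superadditive hWY0 hk fun ι _ _ ρ H hH => ?_⟩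
  · rw [wignerYanase_eq_skewInformation _ (additiveHamiltonian_isHermitian hH)]
    simp only [wignerYanase_eq_skewInformation _ (hH _)]
    exact hWY.weak_superadditivity hk ρ hH
  · have h := hβ ι ρ H hH
    rw [wignerYanase_eq_skewInformation _ (additiveHamiltonian_isHermitian hH)] at h
    simpa only [wignerYanase_eq_skewInformation _ (hH _)] using h
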